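/- Let $N\ge 1$, let $\mathbb R^{I_1\times\cdots\times I_N}$ be the space of real tensors of order $N$, put $d=\lfloor N/2\rfloor$, and let $\bar N=\binom{N}{d}$ if $N$ is odd and $\bar N=\frac12\binom{N}{d}$ if $N$ is even. Let $\mathbf n^1,\dots,\mathbf n^{\bar N}$ be rearrangements of $(1,\dots,N)$ that represent every splitting of the modes into a group of $d$ and a group of $N-d$ modes (for even $N$ up to exchanging the two groups) exactly once. For a tensor $\mathcal X$ let $\mathbf X_{[k]}$ be its unfolding along $\mathbf n^k$, i.e. the matrix whose rows are indexed by the first $d$ modes of $\mathbf n^k$ and whose columns are indexed by the remaining ones, and let $\Upsilon_k$ be the inverse of the map $\mathcal X\mapsto\mathbf X_{[k]}$. Given weights $\alpha_k\ge 0$, $\lambda\ge 0$, a set $\Omega$ of index tuples, and an observed tensor $\mathcal O$, the RC-FCTN problem is $$\min_{\mathcal X,\mathcal E}\ \sum_{k=1}^{\bar N}\alpha_k\|\mathbf X_{[k]}\|_*+\lambda\|\mathcal E\|_1\quad\text{s.t. } \mathcal P_\Omega(\mathcal X+\mathcal E)=\mathcal P_\Omega(\mathcal O),$$ where $\|\cdot\|_*$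 is the nuclear norm (sum of the singular values), $\|\cdot\|_1$ is the sum of the absolute values of the entries, and $\mathcal P_\Omega$ keeps the entries with index in $\Omega$ and sets the others to $0$. Let $\mu_k>0$ $(k=1,\dots,\bar N)$, $\gamma>0$, $\sigma>0$ be penalty parameters and $0<\delta<\frac{1+\sqrt5}{2}$ a step length. From arbitrary initial tensors $\mathcal X^0,\mathcal E^0,\mathcal Z_k^0,\mathcal P^0,\mathcal Q^0$ (and arbitrary $\mathcal L_k^0,\mathcal S^0,\mathcal Y^0$, which are never used) the ADMM iteration produces for $t=0,1,2,\dots$, with all $k=1,\dots,\bar N$: 1. $\mathcal L_k^{t+1}=\Upsilon_k(\mathbf U\,\mathrm{diag}(\max(s_r-\alpha_k/\mu_k,0))\,\mathbf V^T)$, where $(\mathcal X^t-\mathcal Z_k^t/\mu_k)_{[k]}=\mathbf U\,\mathrm{diag}(s_r)\,\mathbf V^T$ is a singular value decomposition; 2. $\mathcal S^{t+1}=\mathrm{soft}_{\lambda/\sigma}(\mathcal E^t-\mathcal Q^t/\sigma)$, where $\mathrm{soft}_\tau(x)=\mathrm{sign}(x)\max(|x|-\tau,0)$ entrywise; 3.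 $\mathcal Y^{t+1}=\mathcal P_\Omega(\mathcal O)+\mathcal P_{\Omega^c}(\mathcal X^t+\mathcal E^t-\mathcal P^t/\gamma)$; 4. with $\mathcal M^t=\sum_k\mu_k(\mathcal L_k^{t+1}+\mathcal Z_k^t/\mu_k)+\gamma(\mathcal Y^{t+1}+\mathcal P^t/\gamma)$, $\mathcal N^t=\gamma(\mathcal Y^{t+1}+\mathcal P^t/\gamma)+\sigma(\mathcal S^{t+1}+\mathcal Q^t/\sigma)$ and $D=\gamma^2-(\sum_k\mu_k+\gamma)(\gamma+\sigma)$, $$\mathcal X^{t+1}=\frac{\gamma\mathcal N^t-(\gamma+\sigma)\mathcal M^t}{D},\qquad \mathcal E^{t+1}=\frac{\gamma\mathcal M^t-(\sum_k\mu_k+\gamma)\mathcal N^t}{D};$$ 5. $\mathcal Z_k^{t+1}=\mathcal Z_k^t+\delta\mu_k(\mathcal L_k^{t+1}-\mathcal X^{t+1})$, $\ \mathcal P^{t+1}=\mathcal P^t+\delta\gamma(\mathcal Y^{t+1}-\mathcal X^{t+1}-\mathcal E^{t+1})$, $\ \mathcal Q^{t+1}=\mathcal Q^t+\delta\sigma(\mathcal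 S^{t+1}-\mathcal E^{t+1})$. Then there is a global minimizer $(\mathcal X^*,\mathcal E^*)$ of the RC-FCTN problem such that, as $t\to\infty$, $\mathcal L_k^t\to\mathcal X^*$ for all $k$, $\mathcal S^t\to\mathcal E^*$, $\mathcal Y^t\to\mathcal X^*+\mathcal E^*$, $\mathcal X^t\to\mathcal X^*$ and $\mathcal E^t\to\mathcal E^*$. -/

import Mathlib

open Filter Topology

noncomputable section

namespace RCFCTN

/-- Real tensors of order `N` and size `I 0 × ⋯ × I (N - 1)`. -/
abbrev Tensor {N : ℕ} (I : Fin N → ℕ) : Type := (∀ i, Fin (I i)) → ℝ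

/-- Row multi-indices of the unfolding along `n`: the modes `n 0, …, n (⌊N/2⌋ - 1)`. -/
abbrev RowIdx {N : ℕ} (I : Fin N → ℕ) (n : Equiv.Perm (Fin N)) : Type :=
  ∀ j : {j : Fin N // (j : ℕ) < N / 2}, Fin (I (n j))

/-- Column multi-indices of the unfolding along `n`: the remaining modes. -/
abbrev ColIdx {N : ℕ} (I : Fin N → ℕ) (n : Equiv.Perm (Fin N)) : Type :=
  ∀ j : {j : Fin N // ¬ (j : ℕ) < N / 2}, Fin (I (n j))

/-- Splitting a tensor index into its row part and its column part; its forward direction sends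
`x` to `(fun j => x (n j), fun j => x (n j))`. -/
def splitIdx {N : ℕ} (I : Fin N → ℕ) (n : Equiv.Perm (Fin N)) :
    (∀ i, Fin (I i)) ≃ RowIdx I n × ColIdx I n :=
  (Equiv.piCongrLeft (fun i => Fin (I i)) n).symm.trans
    (Equiv.piEquivPiSubtypeProd (fun j : Fin N => (j : ℕ) < N / 2) (fun j => Fin (I (n j))))

/-- The generalized unfolding of `X` along the rearrangement `n` of the modes, split after the
first `⌊N/2⌋` of them. Rows and columns are indexed by multi-indices. -/
def unfold {N : ℕ} {I : Fin N → ℕ} (n : Equiv.Perm (Fin N)) (X : Tensor I) :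
    Matrix (RowIdx I n) (ColIdx I n) ℝ :=
  Matrix.of fun r c => X ((splitIdx I n).symm (r, c))

/-- The inverse of `unfold`. -/
def fold {N : ℕ} {I : Fin N → ℕ} (n : Equiv.Perm (Fin N))
    (A : Matrix (RowIdx I n) (ColIdx I n) ℝ) : Tensor I :=
  fun x => A (splitIdx I n x).1 (splitIdx I n x).2

/-- The nuclear norm of a real matrix: the sum of its singular values. -/
def nuclearNorm {p q : Type*} [Fintype p] [Fintype q] [DecidableEq q]
    (A : Matrix p q ℝ) : ℝ :=
  (Matrix.toEuclideanLin A).singularValues.sum fun _ s => s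

/-- The number of essentially different splittings of `N` modes into `⌊N/2⌋` and `N - ⌊N/2⌋`
modes: `N.choose ⌊N/2⌋`, halved when `N` is even, as then a splitting and the one with the two
groups exchanged have transposed unfoldings. -/
def numSplittings (N : ℕ) : ℕ :=
  if Even N then N.choose (N / 2) / 2 else N.choose (N / 2)

/-- The set of modes that index the rows of the unfolding along `n`. -/
def rowModes {N : ℕ} (n : Equiv.Perm (Fin N)) : Finset (Fin N) :=
  (Finset.univ.filter fun j : Fin N => (j : ℕ) < N / 2).map n.toEmbedding

/-- The rearrangements `n k` represent pairwise different splittings of the modes into two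
groups; as there are `numSplittings N` of them, each splitting is represented exactly once. -/
def IsSplittingSystem {N : ℕ} (n : Fin (numSplittings N) → Equiv.Perm (Fin N)) : Prop :=
  ∀ k k', k ≠ k' → rowModes (n k) ≠ rowModes (n k') ∧ rowModes (n k) ≠ (rowModes (n k'))ᶜ

/-- The FCTN nuclear norm with weights `α`. -/
def fctnNorm {N : ℕ} {I : Fin N → ℕ} (n : Fin (numSplittings N) → Equiv.Perm (Fin N))
    (α : Fin (numSplittings N) → ℝ) (X : Tensor I) : ℝ :=
  ∑ k, α k * nuclearNorm (unfold (n k) X)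

/-- The entrywise `ℓ¹` norm. -/
def l1Norm {N : ℕ} {I : Fin N → ℕ} (X : Tensor I) : ℝ := ∑ x, |X x|

open Classical in
/-- The projection that keeps the entries with index in `Ω` and sets the others to zero. -/
def proj {N : ℕ} {I : Fin N → ℕ} (Ω : Set (∀ i, Fin (I i))) (X : Tensor I) : Tensor I :=
  fun x => if x ∈ Ω then X x else 0

/-- The objective function of the RC-FCTN model. -/
def objective {N : ℕ} {I : Fin N → ℕ} (n : Fin (numSplittings N) → Equiv.Perm (Fin N))
    (α : Fin (numSplittings N) → ℝ) (lam : ℝ) (X E : Tensor I) : ℝ :=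
  fctnNorm n α X + lam * l1Norm E

/-- `(X, E)` is a global minimizer of the RC-FCTN problem: minimize the objective subject to
`P_Ω (X + E) = P_Ω O`. -/
def IsGlobalMin {N : ℕ} {I : Fin N → ℕ} (n : Fin (numSplittings N) → Equiv.Perm (Fin N))
    (α : Fin (numSplittings N) → ℝ) (lam : ℝ) (Ω : Set (∀ i, Fin (I i))) (O : Tensor I)
    (X E : Tensor I) : Prop :=
  proj Ω (X + E) = proj Ω O ∧
    ∀ X' E' : Tensor I, proj Ω (X' + E') = proj Ω O →
      objective n α lam X E ≤ objective n α lam X' E'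

/-- `A = U diag(s) Vᵀ` is a (thin) singular value decomposition: `U`, `V` have orthonormal
columns and the entries of `s` are nonnegative. -/
def IsSVD {p q : Type*} [Fintype p] [Fintype q] {r : ℕ} (A : Matrix p q ℝ)
    (U : Matrix p (Fin r) ℝ) (s : Fin r → ℝ) (V : Matrix q (Fin r) ℝ) : Prop :=
  U.transpose * U = 1 ∧ V.transpose * V = 1 ∧ (∀ i, 0 ≤ s i) ∧
    A = U * Matrix.diagonal s * V.transpose

/-- `B` arises from `A` by singular value thresholding at level `τ`: for some singular value
decomposition `A = U diag(s) Vᵀ` one has `B = U diag(max (s - τ) 0) Vᵀ`. -/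
def IsSVT {p q : Type*} [Fintype p] [Fintype q] (τ : ℝ) (A B : Matrix p q ℝ) : Prop :=
  ∃ (r : ℕ) (U : Matrix p (Fin r) ℝ) (s : Fin r → ℝ) (V : Matrix q (Fin r) ℝ),
    IsSVD A U s V ∧ B = U * Matrix.diagonal (fun i => max (s i - τ) 0) * V.transpose

/-- Entrywise soft shrinkage with threshold `τ`. -/
def soft {N : ℕ} {I : Fin N → ℕ} (τ : ℝ) (X : Tensor I) : Tensor I :=
  fun x => Real.sign (X x) * max (|X x| - τ) 0

/-- The variables of the algorithm: the primal blocks `(L, S, Y)` and `(X, E)`, and the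
multipliers `Z`, `P`, `Q`. -/
structure State {N : ℕ} (I : Fin N → ℕ) where
  L : Fin (numSplittings N) → Tensor I
  S : Tensor I
  Y : Tensor I
  X : Tensor I
  E : Tensor I
  Z : Fin (numSplittings N) → Tensor I
  P : Tensor I
  Q : Tensor I

/-- The right-hand side `∑ k, μ k (L k + Z k / μ k) + γ (Y + P / γ)` of the stationarity equation
in `X` of the least squares problem for `(X, E)`. -/
def rhsX {N : ℕ} {I : Fin N → ℕ} (μ : Fin (numSplittings N) → ℝ) (γ : ℝ)
    (L : Fin (numSplittings N) → Tensor I) (Y : Tensor I)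
    (Z : Fin (numSplittings N) → Tensor I) (P : Tensor I) : Tensor I :=
  (∑ k, μ k • (L k + (1 / μ k) • Z k)) + γ • (Y + (1 / γ) • P)

/-- The right-hand side `γ (Y + P / γ) + σ (S + Q / σ)` of the stationarity equation in `E` of the
least squares problem for `(X, E)`. -/
def rhsE {N : ℕ} {I : Fin N → ℕ} (γ σ : ℝ) (S Y P Q : Tensor I) : Tensor I :=
  γ • (Y + (1 / γ) • P) + σ • (S + (1 / σ) • Q)

/-- One pass of the ADMM-based algorithm leads from the state `a` to the state `b`. -/
structure IsStep {N : ℕ} {I : Fin N → ℕ} (n : Fin (numSplittings N) → Equiv.Perm (Fin N))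
    (α : Fin (numSplittings N) → ℝ) (lam : ℝ) (Ω : Set (∀ i, Fin (I i))) (O : Tensor I)
    (μ : Fin (numSplittings N) → ℝ) (γ σ δ : ℝ) (a b : State I) : Prop where
  L_update : ∀ k, ∃ A : Matrix (RowIdx I (n k)) (ColIdx I (n k)) ℝ,
    IsSVT (α k / μ k) (unfold (n k) (a.X - (1 / μ k) • a.Z k)) A ∧ b.L k = fold (n k) A
  S_update : b.S = soft (lam / σ) (a.E - (1 / σ) • a.Q)
  Y_update : b.Y = proj Ω O + proj Ωᶜ (a.X + a.E - (1 / γ) • a.P)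
  X_update : b.X = (1 / (γ ^ 2 - ((∑ k, μ k) + γ) * (γ + σ))) •
    (γ • rhsE γ σ b.S b.Y a.P a.Q - (γ + σ) • rhsX μ γ b.L b.Y a.Z a.P)
  E_update : b.E = (1 / (γ ^ 2 - ((∑ k, μ k) + γ) * (γ + σ))) •
    (γ • rhsX μ γ b.L b.Y a.Z a.P - ((∑ k, μ k) + γ) • rhsE γ σ b.S b.Y a.P a.Q)
  Z_update : ∀ k, b.Z k = a.Z k + (δ * μ k) • (b.L k - b.X)
  P_update : b.P = a.P + (δ * γ) • (b.Y - b.X - b.E)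
  Q_update : b.Q = a.Q + (δ * σ) • (b.S - b.E)

end RCFCTN

end

/-! The scheme is a two-block ADMM: the blocks (L, S, Y) are matched with (X, E) through L_k = X, S
= E, Y = X + E. Scaling each block by the square root of its penalty, and dividing each multiplier
by its penalty, puts everything in one Euclidean space with unit penalty. The problem becomes:
minimize a convex `f` over `V ∩ C`, where `V` is the range of the coupling map and `C` is the
observation constraint on Y. Thresholding, shrinkage and filling in the observed entries form one
proximal step for `f` on `C`, giving u; the update of (X, E) is the orthogonal projection p of u + w
onto `V`, where w is the scaled multiplier.

Split u and w along `V` and `Vᗮ`. The `V`-part of w is multiplied by 1 - δ in each pass, so it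
decays geometrically for every 0 < δ < 2. For the remaining parts, monotonicity of subgradients
yields a Fejér inequality (`IsADMM.descent`): up to an error governed by the decaying part, the
distance to any saddle point does not increase, and its decrease bounds the residuals. Hence the
distances converge, the residuals vanish, every cluster point is a saddle point, and the distance to
it tends to 0 (`IsADMM.exists_limit`).

A saddle point exists because the problem has a minimizer (`exists_isGlobalMin`) and Hahn-Banach
separation supplies the multiplier (`exists_isSaddle`). The thresholding step is treated by the
duality of nuclear and operator norm (`IsSVT.subgradient`). -/

namespace RCFCTN

/-! ### Nuclear norm, duality with the operator norm, singular value thresholding -/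

section NuclearNorm

variable {p q : Type*} [Fintype p] [Fintype q]

/-- The Frobenius inner product of two real matrices. -/
def frob (A B : Matrix p q ℝ) : ℝ := ∑ i, ∑ j, A i j * B i j

theorem frob_eq_trace (A B : Matrix p q ℝ) : frob A B = (A.transpose * B).trace := by
  simp only [frob, Matrix.trace, Matrix.diag, Matrix.mul_apply, Matrix.transpose_apply]
  exact Finset.sum_comm

theorem frob_add_right (A B C : Matrix p q ℝ) : frob A (B + C) = frob A B + frob A C := by
  simp [frob_eq_trace, Matrix.mul_add]

theorem frob_sub_right (A B C : Matrix p q ℝ) : frob A (B - C) = frob A B - frob A C := by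
  simp [frob_eq_trace, Matrix.mul_sub]

theorem frob_smul_right (A B : Matrix p q ℝ) (c : ℝ) : frob A (c • B) = c * frob A B := by
  simp [frob_eq_trace]

theorem frob_svd_svd {r : ℕ} {U : Matrix p (Fin r) ℝ} {V : Matrix q (Fin r) ℝ}
    (hU : U.transpose * U = 1) (hV : V.transpose * V = 1) (a b : Fin r → ℝ) :
    frob (U * Matrix.diagonal a * V.transpose) (U * Matrix.diagonal b * V.transpose) =
      ∑ i, a i * b i := by
  have h : (U * Matrix.diagonal a * V.transpose).transpose *
      (U * Matrix.diagonal b * V.transpose) =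
      V * (Matrix.diagonal a * (U.transpose * U) * Matrix.diagonal b * V.transpose) := by
    simp only [Matrix.transpose_mul, Matrix.transpose_transpose, Matrix.diagonal_transpose,
      Matrix.mul_assoc]
  rw [frob_eq_trace, h, Matrix.trace_mul_comm, hU, Matrix.mul_one, Matrix.mul_assoc, hV,
    Matrix.mul_one, Matrix.diagonal_mul_diagonal, Matrix.trace_diagonal]

theorem frob_svd_right {r : ℕ} {U : Matrix p (Fin r) ℝ} {V : Matrix q (Fin r) ℝ}
    (M : Matrix p q ℝ) (a : Fin r → ℝ) :
    frob M (U * Matrix.diagonal a * V.transpose) =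
      ∑ k, a k * ∑ i, U i k * ∑ j, M i j * V j k := by
  simp only [frob, Matrix.mul_apply (N := V.transpose), Matrix.mul_diagonal,
    Matrix.transpose_apply, Finset.mul_sum]
  conv_lhs => enter [2, i]; rw [Finset.sum_comm]
  rw [Finset.sum_comm]
  refine Finset.sum_congr rfl fun k _ => Finset.sum_congr rfl fun i _ =>
    Finset.sum_congr rfl fun j _ => by ring

variable [DecidableEq q]

/-- The matrix `M`, as a map between Euclidean spaces, has operator norm at most `c`. -/
def OpBound (c : ℝ) (M : Matrix p q ℝ) : Prop :=
  ∀ v, ‖Matrix.toEuclideanLin M v‖ ≤ c * ‖v‖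

/-- Both sides are the trace of MᵀA, which does not depend on the orthonormal basis; this allows
evaluation in a singular basis of A. -/
theorem sum_inner_eq_frob {ι : Type*} [Fintype ι] (M A : Matrix p q ℝ)
    (b : OrthonormalBasis ι ℝ (EuclideanSpace ℝ q)) :
    ∑ i, inner ℝ (Matrix.toEuclideanLin M (b i)) (Matrix.toEuclideanLin A (b i)) = frob M A := by
  have h2 : ∑ j, inner ℝ (Matrix.toEuclideanLin M (EuclideanSpace.basisFun q ℝ j))
      (Matrix.toEuclideanLin A (EuclideanSpace.basisFun q ℝ j)) = frob M A := by
    rw [frob, Finset.sum_comm]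
    refine Finset.sum_congr rfl fun j _ => ?_
    simp [EuclideanSpace.inner_eq_star_dotProduct, dotProduct, mul_comm]
  have h3 := (LinearMap.trace_eq_sum_inner
    ((Matrix.toEuclideanLin M).adjoint ∘ₗ Matrix.toEuclideanLin A) b).symm.trans
    (LinearMap.trace_eq_sum_inner _ (EuclideanSpace.basisFun q ℝ))
  simp only [LinearMap.comp_apply, LinearMap.adjoint_inner_right] at h3
  rw [h3, h2]

/-- An eigenbasis of AᵀA serves as right singular vectors. Left ones are not needed: it suffices
that the images under A are orthogonal with norms s i. -/
theorem exists_singular_basis (A : Matrix p q ℝ) :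
    ∃ (m : ℕ) (b : OrthonormalBasis (Fin m) ℝ (EuclideanSpace ℝ q)) (s : Fin m → ℝ),
      (∀ i, 0 ≤ s i) ∧ nuclearNorm A = ∑ i, s i ∧
      ∀ i j, inner ℝ (Matrix.toEuclideanLin A (b i)) (Matrix.toEuclideanLin A (b j)) =
        if i = j then s i ^ 2 else 0 := by
  set T := Matrix.toEuclideanLin A with hT
  have hs := T.isSymmetric_adjoint_comp_self
  refine ⟨_, hs.eigenvectorBasis rfl, fun i => T.singularValues i,
    fun i => T.singularValues_nonneg i, ?_, fun i j => ?_⟩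
  · rw [nuclearNorm, Finsupp.sum, ← hT]
    rw [Finset.sum_subset (s₂ := Finset.range (Module.finrank ℝ (EuclideanSpace ℝ q)))]
    · exact Finset.sum_range _
    · intro i hi
      by_contra h
      rw [Finsupp.mem_support_iff] at hi
      exact hi (T.singularValues_of_finrank_le (by simpa using h))
    · intro i _ hi
      exact Finsupp.notMem_support_iff.1 hi
  · have h1 := hs.apply_eigenvectorBasis rfl j
    rw [LinearMap.comp_apply] at h1
    rw [← LinearMap.adjoint_inner_right, h1, T.sq_singularValues_fin rfl, inner_smul_right,
      OrthonormalBasis.inner_eq_ite]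
    split_ifs with h
    · subst h; simp
    · simp

theorem nuclearNorm_nonneg (A : Matrix p q ℝ) : 0 ≤ nuclearNorm A := by
  obtain ⟨m, b, s, hs, hn, -⟩ := exists_singular_basis A
  rw [hn]
  exact Finset.sum_nonneg fun i _ => hs i

/-- In the singular basis of A, Cauchy-Schwarz bounds each term by ‖M (b i)‖ ‖A (b i)‖ ≤ c s i. -/
theorem frob_le_mul_nuclearNorm {c : ℝ} {M : Matrix p q ℝ} (hM : OpBound c M)
    (A : Matrix p q ℝ) : frob M A ≤ c * nuclearNorm A := by
  obtain ⟨m, b, s, hs, hn, hA⟩ := exists_singular_basis A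
  rw [hn, ← sum_inner_eq_frob M A b, Finset.mul_sum]
  refine Finset.sum_le_sum fun i _ => (real_inner_le_norm _ _).trans ?_
  have h1 : ‖Matrix.toEuclideanLin A (b i)‖ = s i := by
    have := hA i i
    rw [if_pos rfl, real_inner_self_eq_norm_sq] at this
    exact (pow_left_inj₀ (norm_nonneg _) (hs i) two_ne_zero).1 this
  have h2 := hM (b i)
  rw [b.norm_eq_one, mul_one] at h2
  rw [h1]
  exact mul_le_mul_of_nonneg_right h2 (hs i)

theorem exists_frob_eq_nuclearNorm (A : Matrix p q ℝ) :
    ∃ M : Matrix p q ℝ, OpBound 1 M ∧ frob M A = nuclearNorm A := by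
  obtain ⟨m, b, s, hs, hn, hA⟩ := exists_singular_basis A
  set T := Matrix.toEuclideanLin A
  -- The polar factor of A. Where s i = 0, the convention 0⁻¹ = 0 sends b i to 0, so S is a partial
  -- isometry.
  set S : EuclideanSpace ℝ q →ₗ[ℝ] EuclideanSpace ℝ p :=
    b.toBasis.constr ℝ (fun i => (s i)⁻¹ • T (b i)) with hS
  have hSb : ∀ i, S (b i) = (s i)⁻¹ • T (b i) := fun i => by
    rw [hS, ← b.coe_toBasis, Module.Basis.constr_basis]
  refine ⟨Matrix.toEuclideanLin.symm S, fun v => ?_, ?_⟩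
  · rw [LinearEquiv.apply_symm_apply, one_mul]
    refine le_of_sq_le_sq ?_ (norm_nonneg _)
    have hv : v = ∑ i, inner ℝ (b i) v • b i := (b.sum_repr' v).symm
    have h1 : S v = ∑ i, inner ℝ (b i) v • (s i)⁻¹ • T (b i) := by
      conv_lhs => rw [hv]
      simp [map_sum, hSb]
    have h2 : ‖S v‖ ^ 2 = ∑ i, inner ℝ (b i) v ^ 2 * ((s i)⁻¹ * s i) ^ 2 := by
      rw [← real_inner_self_eq_norm_sq, h1]
      simp only [sum_inner, inner_sum, inner_smul_left, inner_smul_right, hA]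
      refine Finset.sum_congr rfl fun i _ => ?_
      simp
      ring
    rw [h2, ← b.sum_sq_norm_inner_right v]
    refine Finset.sum_le_sum fun i _ => ?_
    rw [Real.norm_eq_abs, sq_abs]
    refine mul_le_of_le_one_right (sq_nonneg _) ?_
    by_cases h : s i = 0 <;> simp [h]
  · rw [← sum_inner_eq_frob _ A b, hn]
    refine Finset.sum_congr rfl fun i _ => ?_
    rw [LinearEquiv.apply_symm_apply, hSb, inner_smul_left, hA i i, if_pos rfl]
    by_cases h : s i = 0
    · simp [h]
    · simp; field_simp

theorem nuclearNorm_add_le (A B : Matrix p q ℝ) :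
    nuclearNorm (A + B) ≤ nuclearNorm A + nuclearNorm B := by
  obtain ⟨M, hM, h⟩ := exists_frob_eq_nuclearNorm (A + B)
  rw [← h, frob_add_right]
  simpa using add_le_add (frob_le_mul_nuclearNorm hM A) (frob_le_mul_nuclearNorm hM B)

theorem nuclearNorm_smul_le {c : ℝ} (hc : 0 ≤ c) (A : Matrix p q ℝ) :
    nuclearNorm (c • A) ≤ c * nuclearNorm A := by
  obtain ⟨M, hM, h⟩ := exists_frob_eq_nuclearNorm (c • A)
  rw [← h, frob_smul_right]
  simpa using mul_le_mul_of_nonneg_left (frob_le_mul_nuclearNorm hM A) hc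

theorem nuclearNorm_zero : nuclearNorm (0 : Matrix p q ℝ) = 0 := by
  simp [nuclearNorm]

/-- Duality with a single-entry matrix ±1; it makes the objective coercive. -/
theorem abs_apply_le_nuclearNorm (A : Matrix p q ℝ) (i : p) (j : q) :
    |A i j| ≤ nuclearNorm A := by
  classical
  have key : ∀ c : ℝ, |c| ≤ 1 → c * A i j ≤ nuclearNorm A := by
    intro c hc
    have hM : OpBound 1 (Matrix.single i j c) := by
      intro v
      have h1 : Matrix.toEuclideanLin (Matrix.single i j c) v =
          EuclideanSpace.single i (c * v j) := by
        ext k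
        simp [Matrix.single_mulVec, Function.update_apply]
      rw [h1, PiLp.norm_single, norm_mul]
      exact mul_le_mul hc (PiLp.norm_apply_le v j) (norm_nonneg _) zero_le_one
    have := frob_le_mul_nuclearNorm hM A
    rw [one_mul] at this
    refine le_trans (le_of_eq ?_) this
    rw [frob, Finset.sum_eq_single i, Finset.sum_eq_single j]
    · simp
    · intro k _ hk; simp [hk.symm]
    · simp
    · intro k _ hk; simp [hk.symm]
    · simp
  refine abs_le.2 ⟨?_, ?_⟩
  · have := key (-1) (by simp); linarith
  · have := key 1 (by simp); linarith

theorem norm_toEuclideanLin_of_orthonormal {p : Type*} [Fintype p] {r : Type*} [Fintype r]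
    [DecidableEq r] {U : Matrix p r ℝ}
    (hU : U.transpose * U = 1) (w : EuclideanSpace ℝ r) : ‖Matrix.toEuclideanLin U w‖ = ‖w‖ := by
  refine (pow_left_inj₀ (norm_nonneg _) (norm_nonneg _) two_ne_zero).1 ?_
  rw [← real_inner_self_eq_norm_sq, ← real_inner_self_eq_norm_sq,
    ← LinearMap.adjoint_inner_right]
  congr 1
  ext k
  classical
  rw [← Matrix.toEuclideanLin_conjTranspose_eq_adjoint, Matrix.conjTranspose_eq_transpose_of_trivial]
  simp [Matrix.mulVec_mulVec, hU]

/-- With w = Uᵀv, ‖w‖² = ⟨v, Uw⟩ ≤ ‖v‖ ‖Uw‖ = ‖v‖ ‖w‖, as U is isometric. -/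
theorem norm_toEuclideanLin_transpose_le [DecidableEq p] {r : Type*} [Fintype r]
    [DecidableEq r] {U : Matrix p r ℝ}
    (hU : U.transpose * U = 1) (v : EuclideanSpace ℝ p) :
    ‖Matrix.toEuclideanLin U.transpose v‖ ≤ ‖v‖ := by
  set w := Matrix.toEuclideanLin U.transpose v with hw
  have h1 : ‖w‖ ^ 2 ≤ ‖v‖ * ‖w‖ := by
    rw [← real_inner_self_eq_norm_sq]
    conv_lhs => rw [hw]
    rw [← Matrix.conjTranspose_eq_transpose_of_trivial,
      Matrix.toEuclideanLin_conjTranspose_eq_adjoint, LinearMap.adjoint_inner_left]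
    rw [← Matrix.toEuclideanLin_conjTranspose_eq_adjoint,
      Matrix.conjTranspose_eq_transpose_of_trivial, ← hw]
    exact (real_inner_le_norm _ _).trans_eq (by rw [norm_toEuclideanLin_of_orthonormal hU])
  rcases (norm_nonneg w).eq_or_lt with h | h
  · rw [← h]; exact norm_nonneg _
  · nlinarith

theorem norm_col_of_orthonormal {p : Type*} [Fintype p] {r : Type*} [Fintype r] [DecidableEq r]
    {U : Matrix p r ℝ} (hU : U.transpose * U = 1) (k : r) :
    ‖(WithLp.toLp 2 (fun i => U i k) : EuclideanSpace ℝ p)‖ = 1 := by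
  have h1 := norm_toEuclideanLin_of_orthonormal hU (EuclideanSpace.single k 1)
  rw [PiLp.norm_single, norm_one] at h1
  rw [← h1]
  congr 1
  ext i
  simp

section SVD

variable {r : ℕ} {U : Matrix p (Fin r) ℝ} {V : Matrix q (Fin r) ℝ}

theorem opBound_svd (hU : U.transpose * U = 1) (hV : V.transpose * V = 1) {a : Fin r → ℝ} {c : ℝ}
    (ha : ∀ i, |a i| ≤ c) (hc : 0 ≤ c) : OpBound c (U * Matrix.diagonal a * V.transpose) := by
  intro v
  have h : Matrix.toEuclideanLin (U * Matrix.diagonal a * V.transpose) v =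
      Matrix.toEuclideanLin U (Matrix.toEuclideanLin (Matrix.diagonal a)
        (Matrix.toEuclideanLin V.transpose v)) := by
    ext; simp [Matrix.mulVec_mulVec, Matrix.mul_assoc]
  rw [h, norm_toEuclideanLin_of_orthonormal hU]
  set w := Matrix.toEuclideanLin V.transpose v
  have hw : ‖w‖ ≤ ‖v‖ := norm_toEuclideanLin_transpose_le hV v
  refine le_trans ?_ (mul_le_mul_of_nonneg_left hw hc)
  refine le_of_sq_le_sq ?_ (by positivity)
  rw [mul_pow, EuclideanSpace.norm_sq_eq, EuclideanSpace.norm_sq_eq, Finset.mul_sum]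
  refine Finset.sum_le_sum fun i _ => ?_
  have : (Matrix.toEuclideanLin (Matrix.diagonal a) w) i = a i * w i := by
    simp [Matrix.mulVec_diagonal]
  rw [this, norm_mul, mul_pow]
  refine mul_le_mul_of_nonneg_right ?_ (sq_nonneg _)
  exact pow_le_pow_left₀ (abs_nonneg _) (ha i) 2

/-- Pairing with a norming M gives ∑ a k ⟨u_k, M v_k⟩, and each inner product is at most 1. This
inequality is all that thresholding requires, so the a k need not be identified with singular
values. -/
theorem nuclearNorm_svd_le (hU : U.transpose * U = 1) (hV : V.transpose * V = 1) {a : Fin r → ℝ}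
    (ha : ∀ i, 0 ≤ a i) : nuclearNorm (U * Matrix.diagonal a * V.transpose) ≤ ∑ i, a i := by
  obtain ⟨M, hM, h⟩ := exists_frob_eq_nuclearNorm (U * Matrix.diagonal a * V.transpose)
  rw [← h, frob_svd_right]
  refine Finset.sum_le_sum fun k _ => mul_le_of_le_one_right (ha k) ?_
  have h1 := hM (WithLp.toLp 2 fun j => V j k)
  have h2 := real_inner_le_norm (WithLp.toLp 2 fun i => U i k : EuclideanSpace ℝ p)
    (Matrix.toEuclideanLin M (WithLp.toLp 2 fun j => V j k))
  rw [norm_col_of_orthonormal hV] at h1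
  rw [norm_col_of_orthonormal hU] at h2
  refine le_trans (le_of_eq ?_) (h2.trans (by simpa using h1))
  simp [EuclideanSpace.inner_eq_star_dotProduct, dotProduct, Matrix.mulVec, mul_comm]

end SVD

/-- Singular value thresholding is the proximal map of the nuclear norm. -/
theorem IsSVT.subgradient {τ : ℝ} (hτ : 0 ≤ τ) {A B : Matrix p q ℝ} (h : IsSVT τ A B)
    (C : Matrix p q ℝ) : τ * nuclearNorm B + frob (A - B) (C - B) ≤ τ * nuclearNorm C := by
  obtain ⟨r, U, s, V, ⟨hU, hV, hs, hA⟩, hB⟩ := h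
  -- Since s - max (s - τ) 0 = min s τ, the residual has operator norm at most τ.
  have hAB : A - B = U * Matrix.diagonal (fun i => min (s i) τ) * V.transpose := by
    rw [hA, hB, ← Matrix.sub_mul, ← Matrix.mul_sub, Matrix.diagonal_sub]
    congr 3
    ext i
    rcases le_total (s i) τ with h | h <;> simp [h]
  have h1 : frob (A - B) C ≤ τ * nuclearNorm C := by
    refine frob_le_mul_nuclearNorm ?_ C
    rw [hAB]
    refine opBound_svd hU hV (fun i => ?_) hτ
    rw [abs_of_nonneg (le_min (hs i) hτ)]
    exact min_le_right _ _
  -- Wherever max (s - τ) 0 is nonzero, min s τ equals τ.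
  have h2 : frob (A - B) B = τ * ∑ i, max (s i - τ) 0 := by
    rw [hAB, hB, frob_svd_svd hU hV, Finset.mul_sum]
    refine Finset.sum_congr rfl fun i _ => ?_
    rcases le_total (s i) τ with h | h <;> simp [h]
  have h3 : nuclearNorm B ≤ ∑ i, max (s i - τ) 0 := by
    rw [hB]
    exact nuclearNorm_svd_le hU hV fun i => le_max_right _ _
  rw [frob_sub_right, h2]
  nlinarith [mul_le_mul_of_nonneg_left h3 hτ]

end NuclearNorm

end RCFCTN

namespace RCFCTN

/-! ### Subgradients and saddle points from Hahn-Banach separation -/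

section Duality

variable {H : Type*} [NormedAddCommGroup H]

/-- Minimality of u along u + K keeps the open strict epigraph of f disjoint from (u + K) × {f u}. A
separating functional has negative vertical component κ and is constant along K; dividing by -κ
gives g. -/
theorem exists_subgradient_vanishing_on [NormedSpace ℝ H] {f : H → ℝ}
    (hf : ConvexOn ℝ Set.univ f) (hfc : Continuous f) (K : Submodule ℝ H) {u : H}
    (hu : ∀ w ∈ K, f u ≤ f (u + w)) :
    ∃ g : H →L[ℝ] ℝ, (∀ w ∈ K, g w = 0) ∧ ∀ v, f u + g (v - u) ≤ f v := by
  have hs : Convex ℝ {z : H × ℝ | f z.1 < z.2} := by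
    simpa using hf.convex_strict_epigraph
  have ho : IsOpen {z : H × ℝ | f z.1 < z.2} :=
    isOpen_lt (hfc.comp continuous_fst) continuous_snd
  have ht : Convex ℝ {z : H × ℝ | z.1 - u ∈ K ∧ z.2 = f u} := by
    rintro ⟨a, x⟩ ⟨ha, hx⟩ ⟨b, y⟩ ⟨hb, hy⟩ s t hs ht hst
    simp only at ha hx hb hy
    refine ⟨?_, ?_⟩
    · have : (s • (a, x) + t • (b, y)).1 - u = s • (a - u) + t • (b - u) := by
        have : u = s • u + t • u := by rw [← add_smul, hst, one_smul]
        simp only [Prod.smul_mk, Prod.mk_add_mk, smul_sub]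
        nth_rewrite 1 [this]
        abel
      rw [this]
      exact K.add_mem (K.smul_mem _ ha) (K.smul_mem _ hb)
    · simp [hx, hy, ← add_mul, hst]
  have hd : Disjoint {z : H × ℝ | f z.1 < z.2} {z : H × ℝ | z.1 - u ∈ K ∧ z.2 = f u} := by
    rw [Set.disjoint_left]
    rintro ⟨a, x⟩ h1 ⟨h2, h3⟩
    have := hu _ h2
    simp only [Set.mem_ofPred_eq, add_sub_cancel] at h1 h3 this
    linarith
  obtain ⟨φ, β, h1, h2⟩ := geometric_hahn_banach_open hs ho ht hd
  set g := φ.comp (ContinuousLinearMap.inl ℝ H ℝ) with hg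
  set κ := φ (0, 1) with hκ
  have hφ : ∀ v x, φ (v, x) = g v + κ * x := by
    intro v x
    have : (v, x) = (v, (0 : ℝ)) + x • ((0 : H), (1 : ℝ)) := by simp
    rw [this, map_add, map_smul, smul_eq_mul, mul_comm]
    rfl
  have h3 : ∀ v x, f v < x → g v + κ * x < β := fun v x h => by
    rw [← hφ]; exact h1 (v, x) h
  have h4 : ∀ w ∈ K, β ≤ g u + g w + κ * f u := fun w hw => by
    have := h2 (u + w, f u) ⟨by simpa using hw, rfl⟩
    rwa [hφ, map_add] at this
  have hβ : β ≤ g u + κ * f u := by simpa using h4 0 K.zero_mem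
  have hκ0 : κ < 0 := by
    have := h3 u (f u + 1) (by linarith)
    linarith
  have hgK : ∀ w ∈ K, g w = 0 := by
    intro w hw
    by_contra hne
    -- If g w ≠ 0, this multiple of w brings the right side of `h4` down to β - 1.
    have := h4 (((β - g u - κ * f u - 1) / g w) • w) (K.smul_mem _ hw)
    rw [map_smul, smul_eq_mul, div_mul_cancel₀ _ hne] at this
    linarith
  have h5 : ∀ v, g v + κ * f v ≤ β := by
    intro v
    refine le_of_forall_pos_le_add fun ε hε => ?_
    have := h3 v (f v + ε / (-κ)) (by linarith [div_pos hε (neg_pos.2 hκ0)])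
    have h6 : κ * (ε / (-κ)) = -ε := by
      rw [div_neg, mul_neg, mul_div_cancel₀ _ hκ0.ne]
    rw [mul_add, h6] at this
    linarith
  refine ⟨(-κ)⁻¹ • g, fun w hw => by simp [hgK w hw], fun v => ?_⟩
  have h6 := (h5 v).trans hβ
  have h7 : (-κ) * (((-κ)⁻¹ • g) (v - u)) = g v - g u := by
    rw [_root_.smul_apply, smul_eq_mul, map_sub, mul_inv_cancel_left₀]
    exact (neg_pos.2 hκ0).ne'
  have h8 : (-κ) * (f u + ((-κ)⁻¹ • g) (v - u)) ≤ (-κ) * f v := by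
    rw [mul_add, h7]; linarith
  exact le_of_mul_le_mul_left h8 (neg_pos.2 hκ0)

variable [InnerProductSpace ℝ H]

/-- `(u, w)` is a saddle point of the Lagrangian of the problem of minimizing `f` over `V ∩ C`,
with `w` the multiplier of the constraint `u ∈ V`. -/
structure IsSaddle (f : H → ℝ) (V : Submodule ℝ H) (C : Set H) (u w : H) : Prop where
  mem_V : u ∈ V
  mem_C : u ∈ C
  mem_orthogonal : w ∈ Vᗮ
  subgradient : ∀ v ∈ C, f u + inner ℝ (-w) (v - u) ≤ f v

theorem IsSaddle.le {f : H → ℝ} {V : Submodule ℝ H} {C : Set H} {u w : H}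
    (h : IsSaddle f V C u w) {v : H} (hv : v ∈ V) (hC : v ∈ C) : f u ≤ f v := by
  have h1 := h.subgradient v hC
  rwa [inner_neg_left, Submodule.inner_left_of_mem_orthogonal (V.sub_mem hv h.mem_V)
    h.mem_orthogonal, neg_zero, add_zero] at h1

/-- A subgradient vanishing on V ⊓ W splits into a functional killing V and one killing W. The
first, with reversed sign, is the multiplier; the second is invisible on C, whose differences with u
lie in W. -/
theorem exists_isSaddle [FiniteDimensional ℝ H] {f : H → ℝ} (hf : ConvexOn ℝ Set.univ f)
    (V W : Submodule ℝ H) {u : H} (hV : u ∈ V) (hu : ∀ v ∈ V, v - u ∈ W → f u ≤ f v) :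
    ∃ w, IsSaddle f V {v | v - u ∈ W} u w := by
  obtain ⟨g, hg, hgu⟩ := exists_subgradient_vanishing_on hf hf.locallyLipschitz.continuous
    (V ⊓ W) (u := u) fun w hw => hu _ (V.add_mem hV hw.1) (by simpa using hw.2)
  have hmem : (g : H →ₗ[ℝ] ℝ) ∈ (V ⊓ W).dualAnnihilator := by
    rw [Submodule.mem_dualAnnihilator]; exact hg
  rw [Subspace.dualAnnihilator_inf_eq] at hmem
  obtain ⟨g₁, hg₁, g₂, hg₂, hgg⟩ := Submodule.mem_sup.1 hmem
  rw [Submodule.mem_dualAnnihilator] at hg₁ hg₂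
  set w := (InnerProductSpace.toDual ℝ H).symm (LinearMap.toContinuousLinearMap g₁) with hw
  have hwi : ∀ v, inner ℝ w v = g₁ v := fun v => by
    rw [hw, InnerProductSpace.toDual_symm_apply]; rfl
  refine ⟨-w, hV, by simp, ?_, fun v hv => ?_⟩
  · rw [Submodule.mem_orthogonal']
    intro v hv
    rw [inner_neg_left, hwi, hg₁ v hv, neg_zero]
  · have h1 := hgu v
    have h2 : g (v - u) = g₁ (v - u) + g₂ (v - u) := by
      rw [← LinearMap.add_apply, hgg]; rfl
    rw [h2, hg₂ _ hv, add_zero, ← hwi] at h1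
    rwa [neg_neg]

end Duality

/-! ### Convergence of almost decreasing sequences -/

section Scalar

theorem tendsto_of_le_add_geometric {D : ℕ → ℝ} {c r : ℝ} (hD : ∀ t, 0 ≤ D t) (hr : 0 ≤ r)
    (hr1 : r < 1) (hc : 0 ≤ c) (h : ∀ t, D (t + 1) ≤ D t + c * r ^ t) :
    ∃ l, Tendsto D atTop (𝓝 l) := by
  have hr' : 0 < 1 - r := by linarith
  -- Adding the tail of the geometric series absorbs all later errors.
  have hanti : Antitone fun t => D t + c * r ^ t / (1 - r) := by
    refine antitone_nat_of_succ_le fun t => ?_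
    have : c * r ^ t / (1 - r) = c * r ^ t + c * r ^ (t + 1) / (1 - r) := by
      field_simp; ring
    rw [this]
    linarith [h t]
  have hbdd : BddBelow (Set.range fun t => D t + c * r ^ t / (1 - r)) :=
    ⟨0, by rintro _ ⟨t, rfl⟩; have := hD t; positivity⟩
  have h1 := tendsto_atTop_ciInf hanti hbdd
  have h2 : Tendsto (fun t => c * r ^ t / (1 - r)) atTop (𝓝 0) := by
    simpa using ((tendsto_pow_atTop_nhds_zero_of_lt_one hr hr1).const_mul c).div_const (1 - r)
  refine ⟨_, (h1.sub h2).congr fun t => ?_⟩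
  simp

end Scalar

/-! ### Convergence of the abstract ADMM for step lengths below 2 -/

section Splitting

variable {H : Type*} [NormedAddCommGroup H] [InnerProductSpace ℝ H]

/-- By orthogonality the hypothesis reads ‖x‖² + ⟨β, y⟩ + ‖y‖² ≤ ⟨z, x⟩. Doubling it and completing
squares in (x, z) and in (β, β + δy) leaves the coefficient 2 - δ on ‖y‖². -/
theorem descent_of_orthogonal {V : Submodule ℝ H} {x z y β : H} {δ : ℝ} (hδ : 0 < δ)
    (hx : x ∈ V) (hz : z ∈ V) (hy : y ∈ Vᗮ) (hβ : β ∈ Vᗮ)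
    (h : inner ℝ (z - x - (β + y)) (-(x + y)) ≤ 0) :
    ‖x‖ ^ 2 + ‖β + δ • y‖ ^ 2 / δ + (2 - δ) * ‖y‖ ^ 2 + ‖x - z‖ ^ 2 ≤
      ‖z‖ ^ 2 + ‖β‖ ^ 2 / δ := by
  have e1 : inner ℝ x y = 0 := hy x hx
  have e2 : inner ℝ z y = 0 := hy z hz
  have e3 : inner ℝ β x = 0 := by rw [real_inner_comm]; exact hβ x hx
  have e4 : inner ℝ y x = 0 := by rw [real_inner_comm]; exact e1
  simp only [inner_neg_right, inner_add_right, inner_sub_left, inner_add_left, e1, e2, e3, e4,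
    real_inner_self_eq_norm_sq] at h
  have h1 : ‖β + δ • y‖ ^ 2 / δ = ‖β‖ ^ 2 / δ + 2 * inner ℝ β y + δ * ‖y‖ ^ 2 := by
    rw [norm_add_sq_real, inner_smul_right, norm_smul, Real.norm_of_nonneg hδ.le]
    field_simp
  rw [h1, norm_sub_sq_real, real_inner_comm z x]
  linarith

/-- The iterates of the two-block ADMM with step length `δ` for minimizing `f` over `V ∩ C`: the
block `u` is updated by a proximal step for `f` on `C`, the block `p` by projection onto `V`, and
`w` is the multiplier of `u = p`. -/
structure IsADMM (f : H → ℝ) (V : Submodule ℝ H) (C : Set H) (δ : ℝ) (u p w : ℕ → H) : Prop where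
  mem_V : ∀ t, p t ∈ V
  mem_C : ∀ t, u (t + 1) ∈ C
  subgradient : ∀ t, ∀ v ∈ C,
    f (u (t + 1)) + inner ℝ (p t - w t - u (t + 1)) (v - u (t + 1)) ≤ f v
  orthogonal : ∀ t, u (t + 1) + w t - p (t + 1) ∈ Vᗮ
  multiplier : ∀ t, w (t + 1) = w t + δ • (u (t + 1) - p (t + 1))

namespace IsADMM

variable {f : H → ℝ} {V : Submodule ℝ H} [V.HasOrthogonalProjection] {C : Set H} {δ : ℝ}
  {u p w : ℕ → H}

theorem p_succ (h : IsADMM f V C δ u p w) (t : ℕ) :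
    p (t + 1) = V.starProjection (u (t + 1)) + V.starProjection (w t) := by
  have h1 := (V.starProjection_apply_eq_zero_iff).2 (h.orthogonal t)
  rw [map_sub, map_add, V.starProjection_eq_self_iff.2 (h.mem_V (t + 1)), sub_eq_zero] at h1
  exact h1.symm

theorem proj_w_succ (h : IsADMM f V C δ u p w) (t : ℕ) :
    V.starProjection (w (t + 1)) = (1 - δ) • V.starProjection (w t) := by
  rw [h.multiplier t, map_add, map_smul, map_sub, V.starProjection_eq_self_iff.2 (h.mem_V (t + 1)),
    h.p_succ]
  module

theorem proj_w (h : IsADMM f V C δ u p w) (t : ℕ) :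
    V.starProjection (w t) = (1 - δ) ^ t • V.starProjection (w 0) := by
  induction t with
  | zero => simp
  | succ t ih => rw [h.proj_w_succ, ih, smul_smul, pow_succ']

theorem w_sub_proj_succ (h : IsADMM f V C δ u p w) (t : ℕ) :
    w (t + 1) - V.starProjection (w (t + 1)) = w t - V.starProjection (w t) +
      δ • (u (t + 1) - V.starProjection (u (t + 1))) := by
  rw [h.proj_w_succ, h.multiplier t, h.p_succ]
  module

/-- Adding the subgradient inequalities at the iterate and at the saddle point gives the
monotonicity that `descent_of_orthogonal` needs. The `V`-part of p - w at time t + 1 is that of u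
plus δ times that of w at time t, which is the only perturbation. The count starts at t + 1, because
the initial p is an arbitrary point of `V` rather than a projection. -/
theorem descent (h : IsADMM f V C δ u p w) (hδ : 0 < δ) {x₀ w₀ : H} (hs : IsSaddle f V C x₀ w₀)
    (t : ℕ) :
    ‖V.starProjection (u (t + 2)) - x₀‖ ^ 2 +
        ‖w (t + 2) - V.starProjection (w (t + 2)) - w₀‖ ^ 2 / δ +
        (2 - δ) * ‖u (t + 2) - V.starProjection (u (t + 2))‖ ^ 2 +
        ‖V.starProjection (u (t + 2)) - x₀ - (V.starProjection (u (t + 1)) - x₀ +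
          δ • V.starProjection (w t))‖ ^ 2 ≤
      ‖V.starProjection (u (t + 1)) - x₀ + δ • V.starProjection (w t)‖ ^ 2 +
        ‖w (t + 1) - V.starProjection (w (t + 1)) - w₀‖ ^ 2 / δ := by
  have hP : ∀ v, V.starProjection v ∈ V := fun v => V.starProjection_apply_mem v
  have hQ : ∀ v, v - V.starProjection v ∈ Vᗮ := fun v => V.sub_starProjection_mem_orthogonal v
  have h1 := h.subgradient (t + 1) x₀ hs.mem_C
  have h2 := hs.subgradient (u (t + 2)) (h.mem_C (t + 1))
  have h3 : inner ℝ (p (t + 1) - w (t + 1) - u (t + 2) + w₀) (x₀ - u (t + 2)) ≤ 0 := by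
    have : inner ℝ (-w₀) (u (t + 2) - x₀) = inner ℝ w₀ (x₀ - u (t + 2)) := by
      rw [← neg_sub x₀, inner_neg_neg]
    rw [inner_add_left, ← this]
    linarith
  have e : w (t + 2) - V.starProjection (w (t + 2)) - w₀ =
      w (t + 1) - V.starProjection (w (t + 1)) - w₀ +
        δ • (u (t + 2) - V.starProjection (u (t + 2))) := by
    rw [h.w_sub_proj_succ (t + 1)]; abel
  rw [e]
  refine descent_of_orthogonal hδ (V.sub_mem (hP _) hs.mem_V)
    (V.add_mem (V.sub_mem (hP _) hs.mem_V) (V.smul_mem _ (hP _))) (hQ _)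
    (Vᗮ.sub_mem (hQ _) hs.mem_orthogonal) ?_
  convert h3 using 2
  · rw [h.p_succ, h.proj_w_succ]; module
  · abel

theorem tendsto_proj_w (h : IsADMM f V C δ u p w) (hδ : 0 < δ) (hδ2 : δ < 2) :
    Tendsto (fun t => V.starProjection (w t)) atTop (𝓝 0) := by
  have h1 : Tendsto (fun t => (1 - δ) ^ t • V.starProjection (w 0)) atTop
      (𝓝 ((0 : ℝ) • V.starProjection (w 0))) :=
    (tendsto_pow_atTop_nhds_zero_of_abs_lt_one
      (abs_lt.2 ⟨by linarith, by linarith⟩)).smul_const _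
  rw [zero_smul] at h1
  exact h1.congr fun t => (h.proj_w t).symm

/-- The distance to a saddle point, in the norm that the iteration almost contracts. -/
noncomputable def saddleDist (V : Submodule ℝ H) [V.HasOrthogonalProjection] (δ : ℝ) (u w : ℕ → H)
    (x₀ w₀ : H) (t : ℕ) : ℝ :=
  √(‖V.starProjection (u (t + 1)) - x₀‖ ^ 2 +
    ‖w (t + 1) - V.starProjection (w (t + 1)) - w₀‖ ^ 2 / δ)

theorem saddleDist_sq (hδ : 0 < δ) (x₀ w₀ : H) (t : ℕ) :
    saddleDist V δ u w x₀ w₀ t ^ 2 = ‖V.starProjection (u (t + 1)) - x₀‖ ^ 2 +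
      ‖w (t + 1) - V.starProjection (w (t + 1)) - w₀‖ ^ 2 / δ :=
  Real.sq_sqrt (by positivity)

/-- By the triangle inequality the perturbation moves the distance by at most δ times the `V`-part
of w, an error linear in the distance itself and therefore summable. -/
theorem saddleDist_descent (h : IsADMM f V C δ u p w) (hδ : 0 < δ) {x₀ w₀ : H}
    (hs : IsSaddle f V C x₀ w₀) (t : ℕ) :
    saddleDist V δ u w x₀ w₀ (t + 1) ^ 2 +
        (2 - δ) * ‖u (t + 2) - V.starProjection (u (t + 2))‖ ^ 2 +
        ‖V.starProjection (u (t + 2)) - x₀ - (V.starProjection (u (t + 1)) - x₀ +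
          δ • V.starProjection (w t))‖ ^ 2 ≤
      (saddleDist V δ u w x₀ w₀ t + δ * ‖V.starProjection (w t)‖) ^ 2 := by
  have h1 := h.descent hδ hs t
  rw [saddleDist_sq hδ]
  refine h1.trans ?_
  have h2 := saddleDist_sq (V := V) (u := u) (w := w) hδ x₀ w₀ t
  have h3 : ‖V.starProjection (u (t + 1)) - x₀‖ ≤ saddleDist V δ u w x₀ w₀ t :=
    Real.le_sqrt_of_sq_le (by
      have : 0 ≤ ‖w (t + 1) - V.starProjection (w (t + 1)) - w₀‖ ^ 2 / δ := by positivity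
      linarith)
  have h4 := norm_add_le (V.starProjection (u (t + 1)) - x₀) (δ • V.starProjection (w t))
  rw [norm_smul, Real.norm_of_nonneg hδ.le] at h4
  have h5 := pow_le_pow_left₀ (norm_nonneg _) h4 2
  have h6 := mul_le_mul_of_nonneg_right h3
    (mul_nonneg hδ.le (norm_nonneg (V.starProjection (w t))))
  nlinarith

theorem exists_tendsto_saddleDist (h : IsADMM f V C δ u p w) (hδ : 0 < δ) (hδ2 : δ < 2) {x₀ w₀ : H}
    (hs : IsSaddle f V C x₀ w₀) : ∃ l, Tendsto (saddleDist V δ u w x₀ w₀) atTop (𝓝 l) := by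
  refine tendsto_of_le_add_geometric (c := δ * ‖V.starProjection (w 0)‖) (r := |1 - δ|)
    (fun t => Real.sqrt_nonneg _) (abs_nonneg _) (abs_lt.2 ⟨by linarith, by linarith⟩)
    (by positivity) fun t => ?_
  have h1 := h.saddleDist_descent hδ hs t
  rw [h.proj_w t, norm_smul, norm_pow, Real.norm_eq_abs] at h1
  refine le_of_sq_le_sq ?_
    (add_nonneg (Real.sqrt_nonneg _) (by positivity))
  refine le_trans ?_ (h1.trans_eq (by ring))
  have h2 : 0 ≤ (2 - δ) * ‖u (t + 2) - V.starProjection (u (t + 2))‖ ^ 2 :=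
    mul_nonneg (by linarith) (by positivity)
  rw [add_assoc]
  exact le_add_of_nonneg_right (add_nonneg h2 (by positivity))

theorem tendsto_residuals (h : IsADMM f V C δ u p w) (hδ : 0 < δ) (hδ2 : δ < 2) {x₀ w₀ : H}
    (hs : IsSaddle f V C x₀ w₀) :
    Tendsto (fun t => u (t + 2) - V.starProjection (u (t + 2))) atTop (𝓝 0) ∧
    Tendsto (fun t => V.starProjection (u (t + 2)) - V.starProjection (u (t + 1)))
      atTop (𝓝 0) := by
  obtain ⟨l, hl⟩ := h.exists_tendsto_saddleDist hδ hδ2 hs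
  have ha := h.tendsto_proj_w hδ hδ2
  have hδ2' : 0 < 2 - δ := by linarith
  have hgap : Tendsto (fun t => (saddleDist V δ u w x₀ w₀ t + δ * ‖V.starProjection (w t)‖) ^ 2 -
      saddleDist V δ u w x₀ w₀ (t + 1) ^ 2) atTop (𝓝 0) := by
    have := ((hl.add (ha.norm.const_mul δ)).pow 2).sub ((hl.comp (tendsto_add_atTop_nat 1)).pow 2)
    simpa using this
  have hsq : ∀ {z : ℕ → H}, Tendsto (fun t => ‖z t‖ ^ 2) atTop (𝓝 0) → Tendsto z atTop (𝓝 0) := by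
    intro z hz
    rw [tendsto_zero_iff_norm_tendsto_zero]
    have := hz.sqrt
    simpa using this
  constructor
  · refine hsq (squeeze_zero (fun t => by positivity) (fun t => ?_)
      (by simpa using hgap.const_mul (2 - δ)⁻¹))
    rw [le_inv_mul_iff₀ hδ2']
    have := h.saddleDist_descent hδ hs t
    linarith [sq_nonneg ‖V.starProjection (u (t + 2)) - x₀ - (V.starProjection (u (t + 1)) - x₀ +
          δ • V.starProjection (w t))‖]
  · have h1 : Tendsto (fun t => V.starProjection (u (t + 2)) - x₀ -
        (V.starProjection (u (t + 1)) - x₀ + δ • V.starProjection (w t))) atTop (𝓝 0) := by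
      refine hsq (squeeze_zero (fun t => by positivity) (fun t => ?_) hgap)
      have := h.saddleDist_descent hδ hs t
      have h2 : 0 ≤ (2 - δ) * ‖u (t + 2) - V.starProjection (u (t + 2))‖ ^ 2 := by positivity
      linarith
    have h2 := h1.add (ha.const_smul δ)
    simp only [smul_zero, add_zero] at h2
    refine h2.congr fun t => ?_
    abel

theorem exists_limit [FiniteDimensional ℝ H] (h : IsADMM f V C δ u p w) (hδ : 0 < δ) (hδ2 : δ < 2)
    (hf : Continuous f) (hC : IsClosed C) (hex : ∃ x₀ w₀, IsSaddle f V C x₀ w₀) :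
    ∃ x ∈ V, x ∈ C ∧ (∀ v ∈ V, v ∈ C → f x ≤ f v) ∧
      Tendsto u atTop (𝓝 x) ∧ Tendsto p atTop (𝓝 x) := by
  obtain ⟨x₀, w₀, hs⟩ := hex
  obtain ⟨l, hl⟩ := h.exists_tendsto_saddleDist hδ hδ2 hs
  obtain ⟨hy, hdx⟩ := h.tendsto_residuals hδ hδ2 hs
  have ha := h.tendsto_proj_w hδ hδ2
  obtain ⟨R, hR⟩ := hl.bddAbove_range
  have hR' : ∀ t, saddleDist V δ u w x₀ w₀ t ≤ R := fun t => hR ⟨t, rfl⟩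
  have hR0 : 0 ≤ R := (Real.sqrt_nonneg _).trans (hR' 0)
  have hb1 : ∀ t, ‖V.starProjection (u (t + 1)) - x₀‖ ≤ R := fun t => by
    refine le_trans (Real.le_sqrt_of_sq_le ?_) (hR' t)
    exact le_add_of_nonneg_right (by positivity)
  have hb2 : ∀ t, ‖w (t + 1) - V.starProjection (w (t + 1)) - w₀‖ ≤ √δ * R := fun t => by
    have h1 : ‖w (t + 1) - V.starProjection (w (t + 1)) - w₀‖ ^ 2 / δ ≤ R ^ 2 := by
      have := saddleDist_sq (V := V) (u := u) (w := w) hδ x₀ w₀ t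
      refine (le_of_le_of_eq ?_ this.symm).trans
        (pow_le_pow_left₀ (Real.sqrt_nonneg _) (hR' t) 2)
      exact le_add_of_nonneg_left (by positivity)
    refine le_of_sq_le_sq ?_ (by positivity)
    rw [mul_pow, Real.sq_sqrt hδ.le]
    rw [div_le_iff₀ hδ] at h1
    linarith
  have hcomp : ∀ t, (V.starProjection (u (t + 1)), w (t + 1) - V.starProjection (w (t + 1))) ∈
      Metric.closedBall x₀ R ×ˢ Metric.closedBall w₀ (√δ * R) := fun t => by
    simp only [Set.mem_prod, mem_closedBall_iff_norm]
    exact ⟨hb1 t, hb2 t⟩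
  -- Only the `V`-part of u and the `Vᗮ`-part of w need compactness; the complementary parts tend to
  -- 0.
  obtain ⟨⟨x, b⟩, -, φ, hφ, hlim⟩ :=
    ((isCompact_closedBall x₀ R).prod (isCompact_closedBall w₀ (√δ * R))).tendsto_subseq hcomp
  have hφt := hφ.tendsto_atTop
  have hx : Tendsto (fun t => V.starProjection (u (φ t + 1))) atTop (𝓝 x) :=
    (continuous_fst.tendsto _).comp hlim
  have hb : Tendsto (fun t => w (φ t + 1) - V.starProjection (w (φ t + 1))) atTop (𝓝 b) :=
    (continuous_snd.tendsto _).comp hlim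
  have hx2 : Tendsto (fun t => V.starProjection (u (φ t + 2))) atTop (𝓝 x) := by
    have := hx.add (hdx.comp hφt)
    simp only [add_zero] at this
    refine this.congr fun t => ?_
    simp
  have hu2 : Tendsto (fun t => u (φ t + 2)) atTop (𝓝 x) := by
    have := hx2.add (hy.comp hφt)
    simp only [add_zero] at this
    refine this.congr fun t => ?_
    simp
  have hp : Tendsto (fun t => p (φ t + 1)) atTop (𝓝 x) := by
    have := hx.add (ha.comp hφt)
    simp only [add_zero] at this
    exact this.congr fun t => (h.p_succ _).symm
  have hw : Tendsto (fun t => w (φ t + 1)) atTop (𝓝 b) := by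
    have := hb.add (ha.comp ((tendsto_add_atTop_nat 1).comp hφt))
    simp only [add_zero] at this
    refine this.congr fun t => ?_
    simp
  -- Along the subsequence p - w - u tends to x - b - x = -b, so the proximal inequality passes to
  -- the saddle inequality.
  have hsad : IsSaddle f V C x b := by
    refine ⟨?_, hC.mem_of_tendsto hu2 (Eventually.of_forall fun t => h.mem_C (φ t + 1)), ?_,
      fun v hv => ?_⟩
    · exact V.closed_of_finiteDimensional.mem_of_tendsto hx
        (Eventually.of_forall fun t => V.starProjection_apply_mem _)
    · exact Vᗮ.closed_of_finiteDimensional.mem_of_tendsto hb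
        (Eventually.of_forall fun t => V.sub_starProjection_mem_orthogonal _)
    · have h1 := ((hf.tendsto x).comp hu2).add (((hp.sub hw).sub hu2).inner
        ((tendsto_const_nhds (x := v)).sub hu2))
      have h2 : x - b - x = -b := by abel
      rw [h2] at h1
      exact le_of_tendsto h1 (Eventually.of_forall fun t => h.subgradient (φ t + 1) v hv)
  obtain ⟨l', hl'⟩ := h.exists_tendsto_saddleDist hδ hδ2 hsad
  -- The distance to the new saddle point converges along the full sequence, so its limit can be
  -- read off along φ.
  have hl0 : l' = 0 := by
    refine tendsto_nhds_unique (hl'.comp hφt) ?_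
    have h1 := (((hx.sub_const x).norm.pow 2).add
      (((hb.sub_const b).norm.pow 2).div_const δ)).sqrt
    simp only [sub_self, norm_zero, ne_eq, OfNat.ofNat_ne_zero, not_false_eq_true, zero_pow,
      zero_div, add_zero, Real.sqrt_zero] at h1
    exact h1
  rw [hl0] at hl'
  have hPu : Tendsto (fun t => V.starProjection (u (t + 1))) atTop (𝓝 x) := by
    rw [tendsto_iff_norm_sub_tendsto_zero]
    refine squeeze_zero (fun t => norm_nonneg _) (fun t => ?_) hl'
    refine Real.le_sqrt_of_sq_le ?_
    exact le_add_of_nonneg_right (by positivity)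
  refine ⟨x, hsad.mem_V, hsad.mem_C, fun v hv hvC => hsad.le hv hvC, ?_, ?_⟩
  · rw [← tendsto_add_atTop_iff_nat 2]
    have := (hPu.comp (tendsto_add_atTop_nat 1)).add hy
    simp only [add_zero] at this
    refine this.congr fun t => ?_
    simp
  · rw [← tendsto_add_atTop_iff_nat 1]
    have := hPu.add ha
    simp only [add_zero] at this
    exact this.congr fun t => (h.p_succ t).symm

end IsADMM

end Splitting

end RCFCTN

namespace RCFCTN

/-! ### Unfoldings, entrywise norm, soft shrinkage, projection -/

section Tensors

variable {N : ℕ} {I : Fin N → ℕ}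

theorem unfold_add (n : Equiv.Perm (Fin N)) (X Y : Tensor I) :
    unfold n (X + Y) = unfold n X + unfold n Y := rfl

theorem unfold_sub (n : Equiv.Perm (Fin N)) (X Y : Tensor I) :
    unfold n (X - Y) = unfold n X - unfold n Y := rfl

theorem unfold_smul (n : Equiv.Perm (Fin N)) (c : ℝ) (X : Tensor I) :
    unfold n (c • X) = c • unfold n X := rfl

theorem unfold_zero (n : Equiv.Perm (Fin N)) : unfold n (0 : Tensor I) = 0 := rfl

theorem unfold_fold (n : Equiv.Perm (Fin N)) (A : Matrix (RowIdx I n) (ColIdx I n) ℝ) :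
    unfold n (fold n A) = A := by
  ext r c
  simp [unfold, fold]

/-- The entrywise inner product of tensors. -/
noncomputable def dot (X Y : Tensor I) : ℝ := ∑ x, X x * Y x

theorem frob_unfold (n : Equiv.Perm (Fin N)) (X Y : Tensor I) :
    frob (unfold n X) (unfold n Y) = dot X Y := by
  rw [frob, dot, ← (splitIdx I n).symm.sum_comp, Fintype.sum_prod_type]
  rfl

theorem abs_apply_le_nuclearNorm_unfold (n : Equiv.Perm (Fin N)) (X : Tensor I)
    (x : ∀ i, Fin (I i)) : |X x| ≤ nuclearNorm (unfold n X) := by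
  have := abs_apply_le_nuclearNorm (unfold n X) (splitIdx I n x).1 (splitIdx I n x).2
  simpa [unfold] using this

theorem abs_apply_le_l1Norm (X : Tensor I) (x : ∀ i, Fin (I i)) : |X x| ≤ l1Norm X :=
  Finset.single_le_sum (f := fun x => |X x|) (fun _ _ => abs_nonneg _) (Finset.mem_univ x)

theorem l1Norm_nonneg (X : Tensor I) : 0 ≤ l1Norm X := Finset.sum_nonneg fun _ _ => abs_nonneg _

theorem l1Norm_add_le (X Y : Tensor I) : l1Norm (X + Y) ≤ l1Norm X + l1Norm Y := by
  rw [l1Norm, l1Norm, l1Norm, ← Finset.sum_add_distrib]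
  exact Finset.sum_le_sum fun x _ => abs_add_le _ _

theorem l1Norm_smul_le {c : ℝ} (hc : 0 ≤ c) (X : Tensor I) : l1Norm (c • X) ≤ c * l1Norm X := by
  rw [l1Norm, l1Norm, Finset.mul_sum]
  exact Finset.sum_le_sum fun x _ => by
    rw [Pi.smul_apply, smul_eq_mul, abs_mul, abs_of_nonneg hc]

theorem soft_subgradient_real {τ : ℝ} (hτ : 0 ≤ τ) (a y : ℝ) :
    τ * |Real.sign a * max (|a| - τ) 0| + (a - Real.sign a * max (|a| - τ) 0) *
      (y - Real.sign a * max (|a| - τ) 0) ≤ τ * |y| := by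
  rcases le_total |a| τ with h | h
  · rw [max_eq_right (by linarith), mul_zero, abs_zero, mul_zero, zero_add, sub_zero, sub_zero]
    calc a * y ≤ |a| * |y| := by rw [← abs_mul]; exact le_abs_self _
      _ ≤ τ * |y| := mul_le_mul_of_nonneg_right h (abs_nonneg _)
  · rw [max_eq_left (by linarith)]
    rcases lt_trichotomy a 0 with ha | ha | ha
    · rw [Real.sign_of_neg ha, abs_of_neg ha] at *
      rw [abs_of_nonpos (by linarith)]
      nlinarith [mul_le_mul_of_nonneg_left (neg_abs_le y) hτ]
    -- Here |a| ≥ τ forces τ = 0, so the value of `Real.sign` at 0 is harmless.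
    · subst ha
      have : τ = 0 := le_antisymm (by simpa using h) hτ
      simp [this]
    · rw [Real.sign_of_pos ha, abs_of_pos ha] at *
      rw [abs_of_nonneg (by linarith)]
      nlinarith [mul_le_mul_of_nonneg_left (le_abs_self y) hτ]

/-- Soft shrinkage is the proximal map of the `ℓ¹` norm. -/
theorem soft_subgradient {τ : ℝ} (hτ : 0 ≤ τ) (A Y : Tensor I) :
    τ * l1Norm (soft τ A) + dot (A - soft τ A) (Y - soft τ A) ≤ τ * l1Norm Y := by
  rw [l1Norm, l1Norm, dot, Finset.mul_sum, Finset.mul_sum, ← Finset.sum_add_distrib]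
  exact Finset.sum_le_sum fun x _ => soft_subgradient_real hτ (A x) (Y x)

theorem proj_eq_iff {Ω : Set (∀ i, Fin (I i))} {X Y : Tensor I} :
    proj Ω X = proj Ω Y ↔ ∀ x ∈ Ω, X x = Y x := by
  constructor
  · intro h x hx
    have := congrFun h x
    simpa [proj, hx] using this
  · intro h
    ext x
    by_cases hx : x ∈ Ω
    · simp [proj, hx, h x hx]
    · simp [proj, hx]

end Tensors

/-! ### The weighted Euclidean space of blocks -/

section Blocks

variable {N : ℕ} {I : Fin N → ℕ}

variable (I) in
/-- The blocks `(L, S, Y)`: `L k` has the label `inl k`, `S` the label `inr false` and `Y` the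
label `inr true`. -/
abbrev Blocks : Type := Fin (numSplittings N) ⊕ Bool → Tensor I

/-- The family of blocks with the given components. -/
def mkBlocks (L : Fin (numSplittings N) → Tensor I) (S Y : Tensor I) : Blocks I :=
  Sum.elim L (fun b => bif b then Y else S)

/-- The blocks that `(X, E)` has to match. -/
def couple : Tensor I × Tensor I →ₗ[ℝ] Blocks I where
  toFun z := mkBlocks (fun _ => z.1) z.2 (z.1 + z.2)
  map_add' a b := by
    ext (k | _ | _) x
    · rfl
    · rfl
    · simp [mkBlocks]; ring
  map_smul' c a := by
    ext (k | _ | _) x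
    · rfl
    · rfl
    · simp [mkBlocks]; ring

variable (I) in
/-- The Euclidean space of blocks. -/
abbrev BlockSpace : Type := EuclideanSpace ℝ ((Fin (numSplittings N) ⊕ Bool) × (∀ i, Fin (I i)))

/-- The blocks with the coordinates of the block `j` scaled by `√(c j)`, so that the Euclidean
inner product becomes the one weighted by `c`. -/
noncomputable def scale (c : Fin (numSplittings N) ⊕ Bool → ℝ) : Blocks I →ₗ[ℝ] BlockSpace I where
  toFun U := WithLp.toLp 2 fun z => √(c z.1) * U z.1 z.2
  map_add' U U' := by ext z; simp [mul_add]
  map_smul' a U := by ext z; simp; ring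

/-- The inverse of `scale c` for positive `c`. -/
noncomputable def unscale (c : Fin (numSplittings N) ⊕ Bool → ℝ) :
    BlockSpace I →ₗ[ℝ] Blocks I where
  toFun h j x := (√(c j))⁻¹ * h (j, x)
  map_add' U U' := by ext j x; simp [mul_add]
  map_smul' a U := by ext j x; simp; ring

variable {c : Fin (numSplittings N) ⊕ Bool → ℝ}

theorem unscale_scale (hc : ∀ j, 0 < c j) (U : Blocks I) : unscale c (scale c U) = U := by
  ext j x
  have := (Real.sqrt_pos.2 (hc j)).ne'
  simp [scale, unscale, this]

theorem scale_unscale (hc : ∀ j, 0 < c j) (h : BlockSpace I) : scale c (unscale c h) = h := by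
  ext ⟨j, x⟩
  have := (Real.sqrt_pos.2 (hc j)).ne'
  simp [scale, unscale, this]

theorem inner_scale (hc : ∀ j, 0 < c j) (U U' : Blocks I) :
    inner ℝ (scale c U) (scale c U') =
      (∑ k, c (Sum.inl k) * dot (U (Sum.inl k)) (U' (Sum.inl k))) +
        (c (Sum.inr true) * dot (U (Sum.inr true)) (U' (Sum.inr true)) +
          c (Sum.inr false) * dot (U (Sum.inr false)) (U' (Sum.inr false))) := by
  have h : inner ℝ (scale c U) (scale c U') = ∑ j, c j * dot (U j) (U' j) := by
    simp only [PiLp.inner_apply, scale, Fintype.sum_prod_type, dot, Finset.mul_sum]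
    refine Finset.sum_congr rfl fun j _ => Finset.sum_congr rfl fun x _ => ?_
    have := Real.mul_self_sqrt (hc j).le
    simp only [LinearMap.coe_mk, AddHom.coe_mk, RCLike.inner_apply, conj_trivial]
    linear_combination (U j x * U' j x) * this
  rw [h, Fintype.sum_sum_type, Fintype.sum_bool]

end Blocks

/-! ### Convexity of the split objective, existence of a minimizer -/

section Objective

variable {N : ℕ} {I : Fin N → ℕ} (n : Fin (numSplittings N) → Equiv.Perm (Fin N))
  {α : Fin (numSplittings N) → ℝ} {lam : ℝ}

/-- The objective function of the split problem. -/
noncomputable def splitObjective (α : Fin (numSplittings N) → ℝ) (lam : ℝ) (U : Blocks I) : ℝ :=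
  (∑ k, α k * nuclearNorm (unfold (n k) (U (Sum.inl k)))) + lam * l1Norm (U (Sum.inr false))

/-- The objective is subadditive and positively homogeneous, hence convex. -/
theorem convexOn_splitObjective (hα : ∀ k, 0 ≤ α k) (hlam : 0 ≤ lam) :
    ConvexOn ℝ Set.univ (splitObjective (I := I) n α lam) := by
  have hadd : ∀ U U' : Blocks I, splitObjective n α lam (U + U') ≤
      splitObjective n α lam U + splitObjective n α lam U' := by
    intro U U'
    simp only [splitObjective, Pi.add_apply, unfold_add]
    have h1 : ∑ k, α k * nuclearNorm (unfold (n k) (U (Sum.inl k)) +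
        unfold (n k) (U' (Sum.inl k))) ≤ ∑ k, (α k * nuclearNorm (unfold (n k) (U (Sum.inl k))) +
          α k * nuclearNorm (unfold (n k) (U' (Sum.inl k)))) :=
      Finset.sum_le_sum fun k _ => by
        rw [← mul_add]
        exact mul_le_mul_of_nonneg_left (nuclearNorm_add_le _ _) (hα k)
    have h2 := mul_le_mul_of_nonneg_left
      (l1Norm_add_le (U (Sum.inr false)) (U' (Sum.inr false))) hlam
    rw [Finset.sum_add_distrib] at h1
    linarith
  have hsmul : ∀ (a : ℝ) (U : Blocks I), 0 ≤ a → splitObjective n α lam (a • U) ≤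
      a * splitObjective n α lam U := by
    intro a U ha
    simp only [splitObjective, Pi.smul_apply, unfold_smul]
    have h1 : ∑ k, α k * nuclearNorm (a • unfold (n k) (U (Sum.inl k))) ≤
        ∑ k, a * (α k * nuclearNorm (unfold (n k) (U (Sum.inl k)))) :=
      Finset.sum_le_sum fun k _ => by
        rw [mul_left_comm]
        exact mul_le_mul_of_nonneg_left (nuclearNorm_smul_le ha _) (hα k)
    have h2 := mul_le_mul_of_nonneg_left (l1Norm_smul_le ha (U (Sum.inr false))) hlam
    rw [← Finset.mul_sum] at h1
    linarith
  refine ⟨convex_univ, fun U _ U' _ a b ha hb _ => ?_⟩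
  exact (hadd _ _).trans (add_le_add (hsmul a U ha) (hsmul b U' hb))

theorem continuous_objective (hα : ∀ k, 0 ≤ α k) (hlam : 0 ≤ lam) :
    Continuous fun z : Tensor I × Tensor I => objective n α lam z.1 z.2 := by
  have h := (convexOn_splitObjective (I := I) n hα hlam).comp_linearMap couple
  exact ConvexOn.locallyLipschitz (f := fun z : Tensor I × Tensor I => objective n α lam z.1 z.2) h
    |>.continuous

theorem objective_nonneg (hα : ∀ k, 0 ≤ α k) (hlam : 0 ≤ lam) (X E : Tensor I) :
    0 ≤ objective n α lam X E :=
  add_nonneg (Finset.sum_nonneg fun k _ => mul_nonneg (hα k) (nuclearNorm_nonneg _))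
    (mul_nonneg hlam (l1Norm_nonneg _))

theorem exists_min_of_bounded_sublevel {F : Type*} [NormedAddCommGroup F] [ProperSpace F]
    {g : F → ℝ} (hg : Continuous g) {s : Set F} (hs : IsClosed s) {z₀ : F} (hz₀ : z₀ ∈ s) {R : ℝ}
    (hR : ∀ z, g z ≤ g z₀ → ‖z‖ ≤ R) : ∃ z ∈ s, ∀ z' ∈ s, g z ≤ g z' := by
  have hball : ∀ z, g z ≤ g z₀ → z ∈ Metric.closedBall (0 : F) R := fun z hz =>
    mem_closedBall_zero_iff.2 (hR z hz)
  obtain ⟨z, hz, hmin⟩ := ((isCompact_closedBall (0 : F) R).inter_right hs).exists_isMinOn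
    ⟨z₀, hball z₀ le_rfl, hz₀⟩ hg.continuousOn
  rw [isMinOn_iff] at hmin
  refine ⟨z, hz.2, fun z' hz' => ?_⟩
  rcases le_total (g z') (g z₀) with h | h
  · exact hmin z' ⟨hball z' h, hz'⟩
  · exact (hmin z₀ ⟨hball z₀ le_rfl, hz₀⟩).trans h

theorem norm_le_of_objective_le (hα : ∀ k, 0 ≤ α k) (hlam : 0 < lam) {k : Fin (numSplittings N)}
    (hk : 0 < α k) {X E : Tensor I} {M : ℝ} (hXE : objective n α lam X E ≤ M) :
    ‖(X, E)‖ ≤ max (M / α k) (M / lam) := by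
  have hM : 0 ≤ M := (objective_nonneg n hα hlam.le X E).trans hXE
  have h1 : α k * nuclearNorm (unfold (n k) X) ≤ fctnNorm n α X :=
    Finset.single_le_sum (f := fun k => α k * nuclearNorm (unfold (n k) X))
      (fun k _ => mul_nonneg (hα k) (nuclearNorm_nonneg _)) (Finset.mem_univ k)
  have h2 : 0 ≤ fctnNorm n α X :=
    Finset.sum_nonneg fun k _ => mul_nonneg (hα k) (nuclearNorm_nonneg _)
  have h3 : 0 ≤ lam * l1Norm E := mul_nonneg hlam.le (l1Norm_nonneg _)
  rw [objective] at hXE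
  rw [Prod.norm_mk]
  refine max_le_max ?_ ?_
  · refine (pi_norm_le_iff_of_nonneg (div_nonneg hM hk.le)).2 fun x => ?_
    rw [Real.norm_eq_abs, le_div_iff₀ hk, mul_comm]
    have := mul_le_mul_of_nonneg_left (abs_apply_le_nuclearNorm_unfold (n k) X x) hk.le
    linarith
  · refine (pi_norm_le_iff_of_nonneg (div_nonneg hM hlam.le)).2 fun x => ?_
    rw [Real.norm_eq_abs, le_div_iff₀ hlam, mul_comm]
    have := mul_le_mul_of_nonneg_left (abs_apply_le_l1Norm E x) hlam.le
    linarith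

/-- Coercivity needs λ and some α k to be positive. Otherwise (0, O) or (O, 0) is feasible with
objective 0. -/
theorem exists_isGlobalMin (hα : ∀ k, 0 ≤ α k) (hlam : 0 ≤ lam) (Ω : Set (∀ i, Fin (I i)))
    (O : Tensor I) : ∃ X E, IsGlobalMin n α lam Ω O X E := by
  rcases hlam.eq_or_lt with hl | hl
  · refine ⟨0, O, by rw [zero_add], fun X E _ => ?_⟩
    refine le_of_eq_of_le ?_ (objective_nonneg n hα hlam X E)
    simp [objective, fctnNorm, ← hl, unfold_zero, nuclearNorm_zero]
  by_cases hα0 : ∀ k, α k = 0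
  · refine ⟨O, 0, by rw [add_zero], fun X E _ => ?_⟩
    refine le_of_eq_of_le ?_ (objective_nonneg n hα hlam X E)
    simp [objective, fctnNorm, hα0, l1Norm]
  push Not at hα0
  obtain ⟨k, hk⟩ := hα0
  have hk : 0 < α k := lt_of_le_of_ne (hα k) hk.symm
  have hclosed : IsClosed {z : Tensor I × Tensor I | proj Ω (z.1 + z.2) = proj Ω O} := by
    simp only [proj_eq_iff, Set.ofPred_forall]
    refine isClosed_iInter fun x => isClosed_iInter fun _ => isClosed_eq ?_ continuous_const
    exact (continuous_apply x).comp (continuous_fst.add continuous_snd)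
  obtain ⟨z, hz, hmin⟩ := exists_min_of_bounded_sublevel
    (continuous_objective (I := I) n hα hlam) hclosed (z₀ := (O, 0))
    (congrArg (proj Ω) (add_zero O)) fun z hz => norm_le_of_objective_le n hα hl hk hz
  exact ⟨z.1, z.2, hz, fun X' E' h' => hmin (X', E') h'⟩

end Objective

/-! ### The updates as an instance of the abstract ADMM -/

section Algorithm

variable {N : ℕ} {I : Fin N → ℕ} {n : Fin (numSplittings N) → Equiv.Perm (Fin N)}
  {α : Fin (numSplittings N) → ℝ} {lam : ℝ} {Ω : Set (∀ i, Fin (I i))} {O : Tensor I}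
  {μ : Fin (numSplittings N) → ℝ} {γ σ δ : ℝ}

/-- The penalty parameters as weights of the blocks. -/
def weights (μ : Fin (numSplittings N) → ℝ) (γ σ : ℝ) : Fin (numSplittings N) ⊕ Bool → ℝ :=
  Sum.elim μ (fun b => bif b then γ else σ)

theorem weights_pos (hμ : ∀ k, 0 < μ k) (hγ : 0 < γ) (hσ : 0 < σ) (j) :
    0 < weights μ γ σ j := by
  rcases j with k | _ | _
  · exact hμ k
  · exact hσ
  · exact hγ

theorem inner_scale_weights (hμ : ∀ k, 0 < μ k) (hγ : 0 < γ) (hσ : 0 < σ) (U U' : Blocks I) :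
    inner ℝ (scale (weights μ γ σ) U) (scale (weights μ γ σ) U') =
      (∑ k, μ k * dot (U (Sum.inl k)) (U' (Sum.inl k))) +
        (γ * dot (U (Sum.inr true)) (U' (Sum.inr true)) +
          σ * dot (U (Sum.inr false)) (U' (Sum.inr false))) :=
  inner_scale (weights_pos hμ hγ hσ) U U'

theorem IsStep.L_subgradient {a b : State I} (h : IsStep n α lam Ω O μ γ σ δ a b)
    (hα : ∀ k, 0 ≤ α k) (hμ : ∀ k, 0 < μ k) (k : Fin (numSplittings N)) (L : Tensor I) :
    α k * nuclearNorm (unfold (n k) (b.L k)) +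
      μ k * dot (a.X - (1 / μ k) • a.Z k - b.L k) (L - b.L k) ≤
        α k * nuclearNorm (unfold (n k) L) := by
  obtain ⟨A, hA, hb⟩ := h.L_update k
  have h1 := hA.subgradient (div_nonneg (hα k) (hμ k).le) (unfold (n k) L)
  have h2 : A = unfold (n k) (b.L k) := by rw [hb, unfold_fold]
  rw [h2, ← unfold_sub, ← unfold_sub, frob_unfold] at h1
  have h3 := mul_le_mul_of_nonneg_left h1 (hμ k).le
  have h4 : μ k * (α k / μ k) = α k := mul_div_cancel₀ _ (hμ k).ne'
  rw [mul_add, ← mul_assoc, ← mul_assoc, h4] at h3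
  exact h3

theorem IsStep.S_subgradient {a b : State I} (h : IsStep n α lam Ω O μ γ σ δ a b)
    (hlam : 0 ≤ lam) (hσ : 0 < σ) (S : Tensor I) :
    lam * l1Norm b.S + σ * dot (a.E - (1 / σ) • a.Q - b.S) (S - b.S) ≤ lam * l1Norm S := by
  have h1 := soft_subgradient (div_nonneg hlam hσ.le) (a.E - (1 / σ) • a.Q) S
  rw [← h.S_update] at h1
  have h3 := mul_le_mul_of_nonneg_left h1 hσ.le
  have h4 : σ * (lam / σ) = lam := mul_div_cancel₀ _ hσ.ne'
  rw [mul_add, ← mul_assoc, ← mul_assoc, h4] at h3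
  exact h3

theorem IsStep.proj_Y {a b : State I} (h : IsStep n α lam Ω O μ γ σ δ a b) :
    proj Ω b.Y = proj Ω O := by
  rw [proj_eq_iff]
  intro x hx
  rw [h.Y_update]
  simp [proj, hx]

theorem IsStep.Y_orthogonal {a b : State I} (h : IsStep n α lam Ω O μ γ σ δ a b) {Y : Tensor I}
    (hY : proj Ω Y = proj Ω O) :
    dot (a.X + a.E - (1 / γ) • a.P - b.Y) (Y - b.Y) = 0 := by
  have hb := h.proj_Y
  rw [proj_eq_iff] at hY hb
  refine Finset.sum_eq_zero fun x _ => ?_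
  by_cases hx : x ∈ Ω
  · simp [hY x hx, hb x hx]
  · rw [h.Y_update]
    simp [proj, hx]

/-- The normal equations of the least squares problem for `(X, E)`. -/
theorem IsStep.normal_equations {a b : State I} (h : IsStep n α lam Ω O μ γ σ δ a b)
    (hμ : ∀ k, 0 < μ k) (hγ : 0 < γ) (hσ : 0 < σ) :
    rhsX μ γ b.L b.Y a.Z a.P = ((∑ k, μ k) + γ) • b.X + γ • b.E ∧
      rhsE γ σ b.S b.Y a.P a.Q = γ • b.X + (γ + σ) • b.E := by
  have hs : 0 ≤ ∑ k, μ k := Finset.sum_nonneg fun k _ => (hμ k).le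
  -- With m = ∑ μ k, the determinant is -(mγ + mσ + γσ) < 0, and the updates are Cramer's rule.
  have hD : γ ^ 2 - ((∑ k, μ k) + γ) * (γ + σ) ≠ 0 := by
    have := mul_pos hγ hσ
    have := mul_nonneg hs hγ.le
    have := mul_nonneg hs hσ.le
    nlinarith
  have hX := h.X_update
  have hE := h.E_update
  constructor <;> rw [hX, hE] <;> ext x <;>
    simp only [Pi.add_apply, Pi.sub_apply, Pi.smul_apply, smul_eq_mul] <;> field_simp <;> ring

/-- The normal equations say that u + w - p is orthogonal, in the weighted inner product, to all
coupled blocks. -/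
theorem dot_normal_equations {L Z : Fin (numSplittings N) → Tensor I} {S Y P Q X E X' E' : Tensor I}
    (hX : rhsX μ γ L Y Z P = ((∑ k, μ k) + γ) • X + γ • E)
    (hE : rhsE γ σ S Y P Q = γ • X + (γ + σ) • E) :
    (∑ k, μ k * dot (L k + (1 / μ k) • Z k - X) X') +
      (γ * dot (Y + (1 / γ) • P - (X + E)) (X' + E') +
        σ * dot (S + (1 / σ) • Q - E) E') = 0 := by
  simp only [dot, Finset.mul_sum]
  rw [Finset.sum_comm, ← Finset.sum_add_distrib, ← Finset.sum_add_distrib]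
  refine Finset.sum_eq_zero fun x _ => ?_
  have h1 := congrFun hX x
  have h2 := congrFun hE x
  simp only [rhsX, rhsE, Pi.add_apply, Pi.sub_apply, Pi.smul_apply, Finset.sum_apply,
    smul_eq_mul] at h1 h2 ⊢
  have h3 : ∑ k, μ k * ((L k x + 1 / μ k * Z k x - X x) * X' x) =
      (∑ k, μ k * (L k x + 1 / μ k * Z k x)) * X' x - (∑ k, μ k) * X x * X' x := by
    rw [Finset.sum_mul, Finset.sum_mul, Finset.sum_mul, ← Finset.sum_sub_distrib]
    exact Finset.sum_congr rfl fun k _ => by ring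
  rw [h3]
  linear_combination X' x * h1 + E' x * h2

/-- The objective and the weighted inner product separate over the blocks, so the proximal
inequality is the sum of those for L_k and S and the orthogonality for Y. Dividing the multipliers
by their penalties makes every multiplier update carry the same factor δ. -/
theorem isADMM_of_isStep (hα : ∀ k, 0 ≤ α k) (hlam : 0 ≤ lam) (hμ : ∀ k, 0 < μ k) (hγ : 0 < γ)
    (hσ : 0 < σ) {s : ℕ → State I} (hs : ∀ t, IsStep n α lam Ω O μ γ σ δ (s t) (s (t + 1))) :
    IsADMM (fun h => splitObjective n α lam (unscale (weights μ γ σ) h))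
      (LinearMap.range (scale (weights μ γ σ) ∘ₗ couple (I := I)))
      {h | proj Ω (unscale (weights μ γ σ) h (Sum.inr true)) = proj Ω O} δ
      (fun t => scale (weights μ γ σ) (mkBlocks (s t).L (s t).S (s t).Y))
      (fun t => scale (weights μ γ σ) (couple ((s t).X, (s t).E)))
      (fun t => scale (weights μ γ σ) (mkBlocks (fun k => (1 / μ k) • (s t).Z k)
        ((1 / σ) • (s t).Q) ((1 / γ) • (s t).P))) := by
  have hc := weights_pos hμ hγ hσ
  refine ⟨fun t => ⟨_, rfl⟩, fun t => ?_, fun t h hh => ?_, fun t => ?_, fun t => ?_⟩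
  · rw [Set.mem_ofPred_eq, unscale_scale hc]
    exact (hs t).proj_Y
  · rw [Set.mem_ofPred_eq] at hh
    set U := unscale (weights μ γ σ) h with hU
    have hhU : h = scale (weights μ γ σ) U := (scale_unscale hc h).symm
    simp only [unscale_scale hc]
    rw [hhU, ← map_sub, ← map_sub, ← map_sub, inner_scale_weights hμ hγ hσ]
    have hL : ∑ k, (α k * nuclearNorm (unfold (n k) ((s (t + 1)).L k)) +
      μ k * dot ((s t).X - (1 / μ k) • (s t).Z k - (s (t + 1)).L k)
        (U (Sum.inl k) - (s (t + 1)).L k)) ≤ ∑ k, α k * nuclearNorm (unfold (n k) (U (Sum.inl k))) :=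
      Finset.sum_le_sum fun k _ => (hs t).L_subgradient hα hμ k _
    have hS := (hs t).S_subgradient hlam hσ (U (Sum.inr false))
    have hY := (hs t).Y_orthogonal hh
    rw [Finset.sum_add_distrib] at hL
    simp only [splitObjective, Pi.sub_apply]
    simp only [couple, mkBlocks, LinearMap.coe_mk, AddHom.coe_mk, Sum.elim_inl, Sum.elim_inr,
      cond_true, cond_false]
    rw [hY]
    linarith
  · rw [Submodule.mem_orthogonal']
    rintro _ ⟨⟨X', E'⟩, rfl⟩
    obtain ⟨hX, hE⟩ := (hs t).normal_equations hμ hγ hσ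
    rw [← map_add, ← map_sub, LinearMap.comp_apply, inner_scale_weights hμ hγ hσ]
    exact dot_normal_equations hX hE
  · rw [← map_sub, ← map_smul, ← map_add]
    congr 1
    ext (k | _ | _) x
    · have := (hμ k).ne'
      simp [mkBlocks, couple, (hs t).Z_update k]
      field_simp
    · simp [mkBlocks, couple, (hs t).Q_update]
      field_simp
    · simp [mkBlocks, couple, (hs t).P_update]
      field_simp
      ring

end Algorithm

end RCFCTN

/-! ### Convergence of the algorithm -/

theorem theorem3 {N : ℕ} (hN : 1 ≤ N) (I : Fin N → ℕ)
    (n : Fin (RCFCTN.numSplittings N) → Equiv.Perm (Fin N)) (hn : RCFCTN.IsSplittingSystem n)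
    (α : Fin (RCFCTN.numSplittings N) → ℝ) (hα : ∀ k, 0 ≤ α k) (lam : ℝ) (hlam : 0 ≤ lam)
    (Ω : Set (∀ i, Fin (I i))) (O : RCFCTN.Tensor I)
    (μ : Fin (RCFCTN.numSplittings N) → ℝ) (hμ : ∀ k, 0 < μ k)
    (γ σ : ℝ) (hγ : 0 < γ) (hσ : 0 < σ)
    (δ : ℝ) (hδ : 0 < δ) (hδ' : δ < (1 + Real.sqrt 5) / 2)
    (s : ℕ → RCFCTN.State I)
    (hs : ∀ t, RCFCTN.IsStep n α lam Ω O μ γ σ δ (s t) (s (t + 1))) :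
    ∃ X E : RCFCTN.Tensor I,
      RCFCTN.IsGlobalMin n α lam Ω O X E ∧
      (∀ k, Tendsto (fun t => (s t).L k) atTop (𝓝 X)) ∧
      Tendsto (fun t => (s t).S) atTop (𝓝 E) ∧
      Tendsto (fun t => (s t).Y) atTop (𝓝 (X + E)) ∧
      Tendsto (fun t => (s t).X) atTop (𝓝 X) ∧
      Tendsto (fun t => (s t).E) atTop (𝓝 E) := by
  open RCFCTN in
  -- The golden ratio is below 2, the bound that the convergence argument uses.
  have hδ2 : δ < 2 := by
    have : Real.sqrt 5 < 3 := by
      rw [Real.sqrt_lt' (by norm_num)]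
      norm_num
    linarith
  set c := weights μ γ σ with hcdef
  have hc : ∀ j, 0 < c j := weights_pos hμ hγ hσ
  have hadmm := isADMM_of_isStep hα hlam hμ hγ hσ hs
  rw [← hcdef] at hadmm
  set f : BlockSpace I → ℝ := fun h => splitObjective n α lam (unscale c h) with hf
  have hfB : ∀ X E, f (scale c (couple (X, E))) = objective n α lam X E := fun X E => by
    rw [hf]
    simp only [unscale_scale hc]
    rfl
  have hfconv : ConvexOn ℝ Set.univ f :=
    (convexOn_splitObjective (I := I) n hα hlam).comp_linearMap (unscale c)
  have hcont : Continuous (unscale (I := I) c) := (unscale c).continuous_of_finiteDimensional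
  have hclosed : IsClosed {h : BlockSpace I | proj Ω (unscale c h (Sum.inr true)) = proj Ω O} := by
    simp only [proj_eq_iff, Set.ofPred_forall]
    refine isClosed_iInter fun x => isClosed_iInter fun _ => isClosed_eq ?_ continuous_const
    exact (continuous_apply x).comp ((continuous_apply _).comp hcont)
  set V := LinearMap.range (scale c ∘ₗ couple (I := I)) with hV
  have hex : ∃ x₀ w₀, IsSaddle f V
      {h | proj Ω (unscale c h (Sum.inr true)) = proj Ω O} x₀ w₀ := by
    obtain ⟨X, E, hXE, hmin⟩ := exists_isGlobalMin n hα hlam Ω O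
    -- The direction space of the affine constraint set, as `exists_isSaddle` expects.
    let W : Submodule ℝ (BlockSpace I) :=
      { carrier := {h | ∀ x ∈ Ω, unscale c h (Sum.inr true) x = 0}
        add_mem' := fun {a b} ha hb x hx => by
          rw [map_add, Pi.add_apply, Pi.add_apply, ha x hx, hb x hx, add_zero]
        zero_mem' := fun x _ => by rw [map_zero]; rfl
        smul_mem' := fun a b hb x hx => by
          rw [map_smul, Pi.smul_apply, Pi.smul_apply, hb x hx, smul_zero] }
    have hWiff : ∀ h, h - scale c (couple (X, E)) ∈ W ↔
        proj Ω (unscale c h (Sum.inr true)) = proj Ω O := by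
      intro h
      rw [← hXE, proj_eq_iff]
      change (∀ x ∈ Ω, _ = _) ↔ _
      simp only [map_sub, unscale_scale hc, Pi.sub_apply, sub_eq_zero]
      rfl
    obtain ⟨w, hw⟩ := exists_isSaddle hfconv V W (u := scale c (couple (X, E))) ⟨(X, E), rfl⟩ (by
      rintro _ ⟨⟨X', E'⟩, rfl⟩ h
      rw [hWiff, LinearMap.comp_apply, unscale_scale hc] at h
      rw [LinearMap.comp_apply, hfB, hfB]
      exact hmin X' E' h)
    refine ⟨scale c (couple (X, E)), w, ?_⟩
    simp only [hWiff] at hw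
    exact hw
  obtain ⟨_, ⟨⟨X, E⟩, rfl⟩, hxC, hmin, hu, hp⟩ :=
    hadmm.exists_limit hδ hδ2 hfconv.locallyLipschitz.continuous hclosed hex
  rw [LinearMap.comp_apply] at hxC hmin hu hp
  rw [Set.mem_ofPred_eq, unscale_scale hc] at hxC
  have hu' := (hcont.tendsto _).comp hu
  have hp' := (hcont.tendsto _).comp hp
  simp only [Function.comp_def, unscale_scale hc, tendsto_pi_nhds (ι := _ ⊕ _)] at hu' hp'
  have hE := hp' (Sum.inr false)
  have hXE := hp' (Sum.inr true)
  refine ⟨X, E, ⟨hxC, fun X' E' h => ?_⟩, fun k => hu' (Sum.inl k), hu' (Sum.inr false),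
    hu' (Sum.inr true), ?_, hE⟩
  · have := hmin (scale c (couple (X', E'))) ⟨(X', E'), rfl⟩ (by
      rw [Set.mem_ofPred_eq, unscale_scale hc]; exact h)
    rwa [hfB, hfB] at this
  -- X is recovered as (X + E) - E, which requires no choice of a splitting k.
  · refine ((hXE.sub hE).congr fun t => ?_).trans (le_of_eq ?_)
    · exact add_sub_cancel_right _ _
    · exact congrArg 𝓝 (add_sub_cancel_right X E)
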